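/- Let $\rho\ge 1$ be an integer and $p>0$. Let $E_{\rho,p}$ be the complex vector space of entire functions $f$ with $\lim_{r\to\infty}\sup_{|z|\ge r}\frac{\ln|f(z)|}{|z|^\rho}\le p$, endowed with the Fréchet topology generated by the norms $\|f\|_n=\sup_{z\in\mathbb C}\exp\!\big(-(p+\tfrac1n)|z|^\rho\big)|f(z)|$, $n=1,2,\dots$. A function on an open subset $U$ of a complex topological vector space is called holomorphic if it is continuous on $U$ and holomorphic along the intersections of $U$ with complex affine lines. A subset $\mathcal V$ of an open set $U$ is called a principal analytic variety in $U$ if $\mathcal V=\{w\in U:\Phi(w)=0\}$ for some holomorphic $\Phi:U\to\mathbb C$ that does not vanish identically on any connected component of $U$. Put $D_R=\{z\in\mathbb C:|z|<R\}$. Let $w_0\in E_{\rho,p}$, let $R>0$ be such that $w_0$ has no critical points on $\partial D_R$, and let $m\ge 0$ be the number of zeros of $w_0'$ in $D_R$, counted with multiplicity. Then there is a connected open neighborhood $U$ of $w_0$ in $E_{\rho,p}$ with the following properties. (a) No $w\in U$ has a critical point on $\partial D_R$, and there is a representation $$w'(z)=P(w,z)\,\Phi(w,z),\qquad P(w,z)=z^m+a_{m-1}(w)z^{m-1}+\dots+a_0(w)\qquad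 (w\in U,\ z\in\overline{D_R}),$$ where $a_0,\dots,a_{m-1}$ are holomorphic in $U$, $\Phi$ is holomorphic in $U\times D_R$, and $\Phi$ does not vanish in $U\times\overline{D_R}$. (b) For $w\in U$ let $\mathrm{CVD}_{U,R}(w)=1$ if $m=0$; if $m\ge1$, let $C(w)$ be the companion matrix of the polynomial $P(w,\cdot)$, let $$W(C)(w)=-\frac1{2\pi i}\oint_{\partial D_R}w(\zeta)\,(C(w)-\zeta I)^{-1}\,d\zeta ,$$ and let $\mathrm{CVD}_{U,R}(w)$ be the discriminant of the characteristic polynomial $\det(W(C)(w)-\lambda I)$. Then $\mathrm{CVD}_{U,R}$ is holomorphic in $U$, and $\mathcal V=\{w\in U:\mathrm{CVD}_{U,R}(w)=0\}$ is a principal analytic variety in $U$. (c) The set of all $w\in U$ whose critical points in $D_R$ are all non-degenerate (that is, $w''\ne0$ there) and at which $w$ takes pairwise different values coincides with $U\setminus\mathcal V$. -/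

import Mathlib

open Set Filter Topology Metric

noncomputable section

/-- `lim_{R → ∞} sup_{|z| ≥ R} ln |f(z)| / |z|^ρ ≤ p`, the limit superior being taken in the
extended reals. (At zeros of `f` the quotient is `0` instead of `-∞`; this is immaterial
for `p > 0`.) -/
def HasGrowthLE (ρ : ℕ) (p : ℝ) (f : ℂ → ℂ) : Prop :=
  limsup (fun z : ℂ => ((Real.log ‖f z‖ / ‖z‖ ^ ρ : ℝ) : EReal)) (cocompact ℂ) ≤ (p : EReal)

/-- For continuous `f` the growth condition says that all the weighted suprema are finite. -/
theorem hasGrowthLE_iff {ρ : ℕ} {p : ℝ} (hρ : 0 < ρ) (hp : 0 < p) {f : ℂ → ℂ}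
    (hf : Continuous f) :
    HasGrowthLE ρ p f ↔ ∀ q > p, ∃ c : ℝ, ∀ z, ‖f z‖ ≤ c * Real.exp (q * ‖z‖ ^ ρ) := by
  unfold HasGrowthLE
  rw [limsup_le_iff]
  constructor
  · intro h q hq
    have h1 := h (q : EReal) (by exact_mod_cast hq)
    have h2 : ∀ᶠ z : ℂ in cocompact ℂ, 1 ≤ ‖z‖ :=
      (tendsto_norm_cocompact_atTop (E := ℂ)).eventually_ge_atTop 1
    obtain ⟨K, hK, hKs⟩ := mem_cocompact.1 (h1.and h2)
    obtain ⟨b, hb⟩ := hK.exists_bound_of_continuousOn hf.continuousOn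
    refine ⟨max 1 b, fun z => ?_⟩
    have hq0 : 0 < q := hp.trans hq
    have hexp : 1 ≤ Real.exp (q * ‖z‖ ^ ρ) := Real.one_le_exp (by positivity)
    by_cases hz : z ∈ K
    · calc ‖f z‖ ≤ max 1 b := (hb z hz).trans (le_max_right _ _)
        _ ≤ max 1 b * Real.exp (q * ‖z‖ ^ ρ) := le_mul_of_one_le_right (by positivity) hexp
    · obtain ⟨hz1, hz2⟩ := hKs hz
      have hz1' : Real.log ‖f z‖ / ‖z‖ ^ ρ < q := by exact_mod_cast hz1
      have hzp : 0 < ‖z‖ ^ ρ := by positivity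
      rw [div_lt_iff₀ hzp] at hz1'
      have h3 : ‖f z‖ ≤ Real.exp (q * ‖z‖ ^ ρ) :=
        (Real.le_exp_log _).trans (Real.exp_le_exp.2 hz1'.le)
      exact h3.trans (le_mul_of_one_le_left (Real.exp_pos _).le (le_max_left _ _))
  · intro h y hy
    obtain ⟨t, ht1, ht2⟩ := EReal.lt_iff_exists_real_btwn.1 hy
    have ht1' : p < t := by exact_mod_cast ht1
    obtain ⟨c, hc⟩ := h ((p + t) / 2) (by linarith)
    have hc1 : ∀ᶠ z : ℂ in cocompact ℂ, 1 ≤ ‖z‖ :=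
      (tendsto_norm_cocompact_atTop (E := ℂ)).eventually_ge_atTop 1
    have hc2 : ∀ᶠ z : ℂ in cocompact ℂ, Real.log (max 1 c) / ((t - p) / 2) < ‖z‖ :=
      (tendsto_norm_cocompact_atTop (E := ℂ)).eventually_gt_atTop _
    filter_upwards [hc1, hc2] with z hz1 hz2
    refine lt_trans ?_ ht2
    have hzp : 0 < ‖z‖ ^ ρ := by positivity
    have hle : ‖z‖ ≤ ‖z‖ ^ ρ := le_self_pow₀ hz1 hρ.ne'
    have goal : Real.log ‖f z‖ / ‖z‖ ^ ρ < t := by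
      rw [div_lt_iff₀ hzp]
      rcases eq_or_ne (f z) 0 with h0 | h0
      · rw [h0]
        simp only [norm_zero, Real.log_zero]
        have : 0 < t := hp.trans ht1'
        positivity
      · have hm : 0 < max 1 c := by positivity
        have h4 : ‖f z‖ ≤ max 1 c * Real.exp ((p + t) / 2 * ‖z‖ ^ ρ) :=
          (hc z).trans (mul_le_mul_of_nonneg_right (le_max_right _ _) (Real.exp_pos _).le)
        have h5 : Real.log ‖f z‖ ≤ Real.log (max 1 c) + (p + t) / 2 * ‖z‖ ^ ρ := by
          have := Real.log_le_log (norm_pos_iff.2 h0) h4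
          rwa [Real.log_mul hm.ne' (Real.exp_pos _).ne', Real.log_exp] at this
        have h6 : Real.log (max 1 c) < ‖z‖ * ((t - p) / 2) :=
          (div_lt_iff₀ (by linarith)).1 hz2
        nlinarith
    exact_mod_cast goal

/-- The entire functions of order `ρ` and type at most `p`, as a linear subspace. -/
def entireSubmodule {ρ : ℕ} {p : ℝ} (hρ : 0 < ρ) (hp : 0 < p) : Submodule ℂ (ℂ → ℂ) where
  carrier := {f | Differentiable ℂ f ∧ HasGrowthLE ρ p f}
  zero_mem' := by
    refine ⟨differentiable_const 0, ?_⟩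
    rw [hasGrowthLE_iff hρ hp continuous_zero]
    exact fun q _ => ⟨0, fun z => by simp⟩
  add_mem' := by
    rintro f g ⟨hf, hf'⟩ ⟨hg, hg'⟩
    refine ⟨hf.add hg, ?_⟩
    rw [hasGrowthLE_iff hρ hp hf.continuous] at hf'
    rw [hasGrowthLE_iff hρ hp hg.continuous] at hg'
    rw [hasGrowthLE_iff hρ hp (hf.add hg).continuous]
    intro q hq
    obtain ⟨a, ha⟩ := hf' q hq
    obtain ⟨b, hb⟩ := hg' q hq
    exact ⟨a + b, fun z => by
      rw [add_mul]
      exact (norm_add_le _ _).trans (add_le_add (ha z) (hb z))⟩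
  smul_mem' := by
    rintro c f ⟨hf, hf'⟩
    refine ⟨hf.const_smul c, ?_⟩
    rw [hasGrowthLE_iff hρ hp hf.continuous] at hf'
    rw [hasGrowthLE_iff hρ hp (hf.const_smul c).continuous]
    intro q hq
    obtain ⟨a, ha⟩ := hf' q hq
    exact ⟨‖c‖ * a, fun z => by
      rw [Pi.smul_apply, norm_smul, mul_assoc]
      exact mul_le_mul_of_nonneg_left (ha z) (norm_nonneg c)⟩

/-- The space `E_{ρ,p}`. It is a type of its own because its topology is not that of
pointwise convergence. -/
def EntireSpace {ρ : ℕ} {p : ℝ} (hρ : 0 < ρ) (hp : 0 < p) : Type :=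
  ↥(entireSubmodule hρ hp)

namespace EntireSpace

variable {ρ : ℕ} {p : ℝ} {hρ : 0 < ρ} {hp : 0 < p}

instance : AddCommGroup (EntireSpace hρ hp) :=
  inferInstanceAs (AddCommGroup ↥(entireSubmodule hρ hp))

instance : Module ℂ (EntireSpace hρ hp) :=
  inferInstanceAs (Module ℂ ↥(entireSubmodule hρ hp))

instance : CoeFun (EntireSpace hρ hp) (fun _ => ℂ → ℂ) := ⟨fun w => w.1⟩

/-- The weight `v_{n+1}(|z|) = exp(-(p + 1/(n+1)) |z|^ρ)`, for `n = 0, 1, 2, …`. -/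
def weight (ρ : ℕ) (p : ℝ) (n : ℕ) (z : ℂ) : ℝ :=
  Real.exp (-((p + 1 / ((n : ℝ) + 1)) * ‖z‖ ^ ρ))

theorem weight_nonneg (n : ℕ) (z : ℂ) : 0 ≤ weight ρ p n z := (Real.exp_pos _).le

theorem bddAbove_weight_mul (n : ℕ) (w : EntireSpace hρ hp) :
    BddAbove (range fun z => weight ρ p n z * ‖w z‖) := by
  obtain ⟨c, hc⟩ := (hasGrowthLE_iff hρ hp w.2.1.continuous).1 w.2.2
    (p + 1 / ((n : ℝ) + 1)) (lt_add_of_pos_right _ (by positivity))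
  refine ⟨c, ?_⟩
  rintro _ ⟨z, rfl⟩
  have h := mul_le_mul_of_nonneg_left (hc z) (weight_nonneg (ρ := ρ) (p := p) n z)
  refine h.trans (le_of_eq ?_)
  rw [weight, Real.exp_neg]
  field_simp

/-- The norm `‖w‖_{n+1} = sup_z v_{n+1}(|z|) |w(z)|`, for `n = 0, 1, 2, …`. -/
def weightedNorm (hρ : 0 < ρ) (hp : 0 < p) (n : ℕ) : Seminorm ℂ (EntireSpace hρ hp) :=
  Seminorm.of (fun w => ⨆ z, weight ρ p n z * ‖w z‖)
    (by
      intro f g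
      refine ciSup_le fun z => ?_
      calc weight ρ p n z * ‖(f + g) z‖
          ≤ weight ρ p n z * (‖f z‖ + ‖g z‖) :=
            mul_le_mul_of_nonneg_left (norm_add_le (f z) (g z)) (weight_nonneg n z)
        _ = weight ρ p n z * ‖f z‖ + weight ρ p n z * ‖g z‖ := mul_add _ _ _
        _ ≤ _ := add_le_add (le_ciSup (bddAbove_weight_mul n f) z)
            (le_ciSup (bddAbove_weight_mul n g) z))
    (by
      intro c f
      rw [Real.mul_iSup_of_nonneg (norm_nonneg c)]
      refine congrArg iSup (funext fun z => ?_)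
      have h : ‖(c • f) z‖ = ‖c‖ * ‖f z‖ := norm_smul c (f z)
      rw [h]
      ring)

/-- The Fréchet topology generated by the weighted norms. -/
instance : TopologicalSpace (EntireSpace hρ hp) :=
  (SeminormFamily.moduleFilterBasis (𝕜 := ℂ) (weightedNorm hρ hp)).topology

end EntireSpace

/-- A function on an open subset `U` of a complex topological vector space is holomorphic if it
is continuous on `U` and holomorphic on the intersections of `U` with complex affine lines. -/
def HolomorphicOn {E : Type*} [AddCommGroup E] [Module ℂ E] [TopologicalSpace E]
    (f : E → ℂ) (U : Set E) : Prop :=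
  ContinuousOn f U ∧
    ∀ w h : E, DifferentiableOn ℂ (fun t : ℂ => f (w + t • h)) {t : ℂ | w + t • h ∈ U}

/-- `V` is a principal analytic variety in the open set `U`: the zero set in `U` of a holomorphic
function that does not vanish identically on any connected component of `U`. -/
def IsPrincipalAnalyticVariety {E : Type*} [AddCommGroup E] [Module ℂ E] [TopologicalSpace E]
    (U V : Set E) : Prop :=
  IsOpen U ∧ ∃ Φ : E → ℂ, HolomorphicOn Φ U ∧
    (∀ x ∈ U, ∃ y ∈ connectedComponentIn U x, Φ y ≠ 0) ∧ V = {w ∈ U | Φ w = 0}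

/-- The companion matrix of the monic polynomial `y^m + c_{m-1} y^{m-1} + ⋯ + c_0`: ones below
the diagonal, last column `-c_0, …, -c_{m-1}`. -/
def companionMatrix {m : ℕ} (c : Fin m → ℂ) : Matrix (Fin m) (Fin m) ℂ :=
  Matrix.of fun i j =>
    if (j : ℕ) + 1 = m then -c i else if (i : ℕ) = (j : ℕ) + 1 then 1 else 0

/-- The function `f` of the matrix `A`, over the circle `|ζ| = R`, entry by entry:
`-(1 / 2πi) ∮ f(ζ) (A - ζ I)⁻¹ dζ`. -/
def matrixFunction {m : ℕ} (R : ℝ) (f : ℂ → ℂ) (A : Matrix (Fin m) (Fin m) ℂ) :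
    Matrix (Fin m) (Fin m) ℂ :=
  Matrix.of fun i j =>
    -((2 * (Real.pi : ℂ) * Complex.I)⁻¹ *
      ∮ ζ in C(0, R), f ζ * (A - ζ • (1 : Matrix (Fin m) (Fin m) ℂ))⁻¹ i j)

/-- The number of zeros of `f` in the open disk `|z| < R`, counted with multiplicity. -/
def zeroCount (R : ℝ) (f : ℂ → ℂ) : ℕ :=
  ∑ᶠ z ∈ ball (0 : ℂ) R, analyticOrderNatAt f z

section Discriminant

variable {ρ : ℕ} {p : ℝ} {hρ : 0 < ρ} {hp : 0 < p}

/-- A Weierstrass representation of `(w, z) ↦ w'(z)` over the neighborhood `U` of `w₀` and the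
disk `D_R`: `w'(z) = (z^m + a_{m-1}(w) z^{m-1} + ⋯ + a_0(w)) Φ(w, z)`, where `m` is the number of
zeros of `w₀'` in `D_R`, the `a_k` are holomorphic in `U`, and `Φ` is holomorphic in `U × D_R` and
has no zeros in `U × closure D_R`; moreover no `w ∈ U` has critical points on the circle. -/
structure WeierstrassRepresentation (w₀ : EntireSpace hρ hp) (R : ℝ)
    (U : Set (EntireSpace hρ hp)) where
  isOpen : IsOpen U
  mem : w₀ ∈ U
  ne_zero_on_circle : ∀ w ∈ U, ∀ z ∈ sphere (0 : ℂ) R, deriv w z ≠ 0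
  coeff : Fin (zeroCount R (deriv w₀)) → EntireSpace hρ hp → ℂ
  coeff_holomorphic : ∀ k, HolomorphicOn (coeff k) U
  unit : EntireSpace hρ hp → ℂ → ℂ
  unit_holomorphic :
    HolomorphicOn (fun x : EntireSpace hρ hp × ℂ => unit x.1 x.2) (U ×ˢ ball (0 : ℂ) R)
  unit_ne_zero : ∀ w ∈ U, ∀ z ∈ closedBall (0 : ℂ) R, unit w z ≠ 0
  factorization : ∀ w ∈ U, ∀ z ∈ closedBall (0 : ℂ) R,
    deriv w z = (z ^ zeroCount R (deriv w₀) + ∑ k, coeff k w * z ^ (k : ℕ)) * unit w z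

/-- The critical values `R`-truncated discriminant `CVD_{U,R}(w)`: the discriminant of the
characteristic polynomial of the function `w` of the companion matrix `C(w)` of the Weierstrass
polynomial, and `1` if this polynomial has degree `0`. (The discriminants of `det(A - λI)` and
`det(λI - A)` agree.) -/
def WeierstrassRepresentation.cvd {w₀ : EntireSpace hρ hp} {R : ℝ}
    {U : Set (EntireSpace hρ hp)} (D : WeierstrassRepresentation w₀ R U)
    (w : EntireSpace hρ hp) : ℂ :=
  if zeroCount R (deriv w₀) = 0 then 1
  else (matrixFunction R w (companionMatrix fun k => D.coeff k w)).charpoly.discr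

/-- All critical points of `f` in the open disk `|z| < R` are non-degenerate, and `f` takes
pairwise different values at them. -/
def HasSimpleCriticalValues (R : ℝ) (f : ℂ → ℂ) : Prop :=
  (∀ z ∈ ball (0 : ℂ) R, deriv f z = 0 → deriv (deriv f) z ≠ 0) ∧
    InjOn f {z ∈ ball (0 : ℂ) R | deriv f z = 0}

end Discriminant

end

/-! Everything is expressed through the multiset Z(w) of zeros of w' in D_R. Point values of
derivatives on a disk are controlled by the first defining norm, so on a small ball U of that norm
around w₀ no w' vanishes on the circle. The ball is convex, hence connected, and for w in U one can
write w'(z) = ∏(z - a) g(z) with a running over Z(w) and g zero-free on the closed disk.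

The generalized argument principle (`circleIntegral_logDeriv`) writes ∑ φ(a), a in Z(w), as a circle
integral of φ w''/w', which is holomorphic in w (`holomorphicOn_sum_map`). Taking φ = 1 gives an
integer-valued continuous function on a connected set, so |Z(w)| = m throughout U. Taking φ = z^k
and φ = w^k gives the power sums of the critical points and of the critical values. By Newton's
identities the coefficients of ∏(X - a) and of ∏(X - w(a)) are then holomorphic. The factor g is
recovered from w'/∏(z - a) on the circle by Cauchy's formula.

The contour integral W(C) equals r(C) for a polynomial r interpolating w at the roots of P. Spectral
mapping with multiplicities therefore gives it the characteristic polynomial ∏(X - w(a)). Its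
discriminant is, up to sign, a Sylvester determinant in holomorphic coefficients. It is nonzero
exactly when the w(a) are distinct as a multiset, and this covers both conditions in (c), because a
degenerate critical point is listed more than once.

The discriminant does not vanish identically on U: adding a multiple of z makes the critical points
simple, and adding a multiple of a polynomial h with h(a) = a and h'(a) = 0 fixes those points while
separating their values. -/

noncomputable section

/-! ### Algebra of holomorphic functions on topological vector spaces -/

namespace HolomorphicOn

variable {E : Type*} [AddCommGroup E] [Module ℂ E] [TopologicalSpace E] {U : Set E} {f g : E → ℂ}

theorem const (c : ℂ) : HolomorphicOn (fun _ : E => c) U :=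
  ⟨continuousOn_const, fun _ _ => differentiableOn_const c⟩

theorem add (hf : HolomorphicOn f U) (hg : HolomorphicOn g U) :
    HolomorphicOn (fun w => f w + g w) U :=
  ⟨hf.1.add hg.1, fun w h => (hf.2 w h).add (hg.2 w h)⟩

theorem mul (hf : HolomorphicOn f U) (hg : HolomorphicOn g U) :
    HolomorphicOn (fun w => f w * g w) U :=
  ⟨hf.1.mul hg.1, fun w h => (hf.2 w h).mul (hg.2 w h)⟩

theorem pow (hf : HolomorphicOn f U) (n : ℕ) : HolomorphicOn (fun w => f w ^ n) U :=
  ⟨hf.1.pow n, fun w h => (hf.2 w h).pow n⟩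

theorem sub (hf : HolomorphicOn f U) (hg : HolomorphicOn g U) :
    HolomorphicOn (fun w => f w - g w) U :=
  ⟨hf.1.sub hg.1, fun w h => (hf.2 w h).sub (hg.2 w h)⟩

theorem inv (hf : HolomorphicOn f U) (h0 : ∀ w ∈ U, f w ≠ 0) :
    HolomorphicOn (fun w => (f w)⁻¹) U :=
  ⟨hf.1.inv₀ h0, fun w h => (hf.2 w h).inv fun _ ht => h0 _ ht⟩

theorem div (hf : HolomorphicOn f U) (hg : HolomorphicOn g U) (h0 : ∀ w ∈ U, g w ≠ 0) :
    HolomorphicOn (fun w => f w / g w) U := by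
  simpa only [div_eq_mul_inv] using hf.mul (hg.inv h0)

theorem sum {ι : Type*} {s : Finset ι} {F : ι → E → ℂ}
    (hF : ∀ i ∈ s, HolomorphicOn (F i) U) : HolomorphicOn (fun w => ∑ i ∈ s, F i w) U :=
  ⟨continuousOn_finsetSum _ fun i hi => (hF i hi).1,
    fun w h => DifferentiableOn.fun_sum fun i hi => (hF i hi).2 w h⟩

theorem prod {ι : Type*} {s : Finset ι} {F : ι → E → ℂ}
    (hF : ∀ i ∈ s, HolomorphicOn (F i) U) : HolomorphicOn (fun w => ∏ i ∈ s, F i w) U :=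
  ⟨continuousOn_finsetProd _ fun i hi => (hF i hi).1,
    fun w h => DifferentiableOn.fun_finsetProd fun i hi => (hF i hi).2 w h⟩

theorem congr (hf : HolomorphicOn f U) (hfg : EqOn g f U) : HolomorphicOn g U :=
  ⟨hf.1.congr hfg, fun w h => (hf.2 w h).congr fun _ ht => hfg ht⟩

theorem matrix_det {n : Type*} [Fintype n] [DecidableEq n] {A : E → Matrix n n ℂ}
    (hA : ∀ i j, HolomorphicOn (fun w => A w i j) U) : HolomorphicOn (fun w => (A w).det) U := by
  simp only [Matrix.det_apply, zsmul_eq_mul, Units.smul_def]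
  exact sum fun σ _ => (const _).mul (prod fun i _ => hA _ _)

theorem comp_fst {F : Type*} [AddCommGroup F] [Module ℂ F] [TopologicalSpace F]
    (hf : HolomorphicOn f U) (V : Set F) :
    HolomorphicOn (fun x : E × F => f x.1) (U ×ˢ V) :=
  ⟨hf.1.comp continuousOn_fst fun _ hx => hx.1,
    fun w h => (hf.2 w.1 h.1).mono fun _ ht => ht.1⟩

end HolomorphicOn

theorem holomorphicOn_snd {E : Type*} [AddCommGroup E] [Module ℂ E] [TopologicalSpace E]
    (U : Set (E × ℂ)) : HolomorphicOn (fun x : E × ℂ => x.2) U :=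
  ⟨continuousOn_snd, fun w h => by
    simp only [Prod.snd_add, Prod.smul_snd, smul_eq_mul]
    fun_prop⟩

/-! ### Circle integrals with a holomorphic parameter -/

/-- Differentiation under the integral sign for a jointly continuous integrand that is
holomorphic in the parameter. -/
theorem differentiableOn_circleIntegral {G : ℂ → ℂ → ℂ} {T : Set ℂ} (hT : IsOpen T) {R : ℝ}
    (hR : 0 ≤ R) (hc : ContinuousOn (fun x : ℂ × ℂ => G x.1 x.2) (T ×ˢ sphere 0 R))
    (hd : ∀ ζ ∈ sphere (0 : ℂ) R, DifferentiableOn ℂ (fun t => G t ζ) T) :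
    DifferentiableOn ℂ (fun t => ∮ ζ in C(0, R), G t ζ) T := by
  intro t₀ ht₀
  refine DifferentiableAt.differentiableWithinAt ?_
  obtain ⟨r', hr', hrT'⟩ := Metric.isOpen_iff.1 hT t₀ ht₀
  -- Circles of radius r about any point of `ball t₀ r` must stay in T for the Cauchy estimate
  -- below.
  obtain ⟨r, hr, hrr'⟩ : ∃ r > 0, r + r < r' := ⟨r' / 3, by positivity, by linarith⟩
  have hrT : closedBall t₀ (r + r) ⊆ T := (closedBall_subset_ball hrr').trans hrT'
  have hball : ∀ t ∈ ball t₀ r, closedBall t r ⊆ closedBall t₀ (r + r) := fun t ht =>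
    closedBall_subset_closedBall' (by have := mem_ball.1 ht; linarith)
  obtain ⟨M, hM⟩ := ((isCompact_closedBall t₀ (r + r)).prod
    (isCompact_sphere (0 : ℂ) R)).exists_bound_of_continuousOn
      (hc.mono (prod_mono hrT subset_rfl))
  have hcirc : ∀ θ : ℝ, circleMap 0 R θ ∈ sphere (0 : ℂ) R := circleMap_mem_sphere 0 hR
  let F : ℂ → ℝ → ℂ := fun t θ => deriv (circleMap 0 R) θ • G t (circleMap 0 R θ)
  have hFc : ∀ t ∈ T, Continuous (F t) := by
    intro t ht
    have h1 : Continuous fun θ : ℝ => G t (circleMap 0 R θ) := by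
      rw [← continuousOn_univ]
      exact hc.comp (f := fun θ : ℝ => (t, circleMap 0 R θ)) (by fun_prop)
        fun θ _ => ⟨ht, hcirc θ⟩
    have h2 : Continuous fun θ : ℝ => deriv (circleMap 0 R) θ := by
      simp only [deriv_circleMap]; fun_prop
    exact h2.smul h1
  have hFd : ∀ θ, ∀ t ∈ ball t₀ r, HasDerivAt (fun t => F t θ) (deriv (fun t => F t θ) t) t := by
    intro θ t ht
    have htT : t ∈ T := hrT (hball t ht (mem_closedBall_self hr.le))
    exact (((hd _ (hcirc θ)).differentiableAt (hT.mem_nhds htT)).const_smul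
      (deriv (circleMap 0 R) θ)).hasDerivAt
  have hFdiff : ∀ θ, DifferentiableOn ℂ (fun t => F t θ) T := fun θ =>
    (hd _ (hcirc θ)).const_smul (deriv (circleMap 0 R) θ)
  have key := intervalIntegral.hasDerivAt_integral_of_dominated_loc_of_deriv_le
    (𝕜 := ℂ) (μ := MeasureTheory.volume) (a := 0) (b := 2 * Real.pi)
    (F := F) (F' := fun t θ => deriv (fun t => F t θ) t) (x₀ := t₀) (s := ball t₀ r)
    (bound := fun _ => |R| * M / r) (ball_mem_nhds t₀ hr)
    (by
      filter_upwards [hT.mem_nhds ht₀] with t ht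
      exact (hFc t ht).aestronglyMeasurable)
    ((hFc t₀ ht₀).intervalIntegrable _ _)
    (by
      -- The t-derivative at t₀ is measurable in θ as a pointwise limit of continuous difference
      -- quotients with increments u n; the shift by N keeps t₀ + u n in T.
      let u : ℕ → ℂ := fun n => ((1 : ℂ) / ((n : ℂ) + 1))
      have hu : Tendsto u atTop (𝓝[≠] 0) := by
        refine tendsto_nhdsWithin_iff.2 ⟨tendsto_one_div_add_atTop_nhds_zero_nat, ?_⟩
        filter_upwards with n
        exact one_div_ne_zero (Nat.cast_add_one_ne_zero n)
      have hu0 : Tendsto (fun n => t₀ + u n) atTop (𝓝 t₀) := by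
        simpa using tendsto_const_nhds.add (tendsto_nhds_of_tendsto_nhdsWithin hu)
      obtain ⟨N, hN⟩ := eventually_atTop.1 (hu0.eventually (hT.mem_nhds ht₀))
      refine aestronglyMeasurable_of_tendsto_ae atTop
        (f := fun n θ => (u (n + N))⁻¹ • (F (t₀ + u (n + N)) θ - F t₀ θ)) (fun n => ?_) ?_
      · exact (((hFc _ (hN _ (Nat.le_add_left N n))).sub (hFc _ ht₀)).const_smul
          (u (n + N))⁻¹).aestronglyMeasurable
      · filter_upwards with θ
        have h1 := (hFd θ t₀ (mem_ball_self hr)).tendsto_slope_zero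
        exact h1.comp (hu.comp (tendsto_add_atTop_nat N)))
    (by
      filter_upwards with θ _ t ht
      refine Complex.norm_deriv_le_of_forall_mem_sphere_norm_le hr
        (((hFdiff θ).mono ((hball t ht).trans hrT)).diffContOnCl_ball subset_rfl) fun z hz => ?_
      have h1 : ‖deriv (circleMap 0 R) θ‖ = |R| := by simp [deriv_circleMap]
      rw [norm_smul, h1]
      exact mul_le_mul_of_nonneg_left
        (hM (z, circleMap 0 R θ) ⟨hball t ht (sphere_subset_closedBall hz), hcirc θ⟩)
        (abs_nonneg R))
    intervalIntegrable_const
    (by filter_upwards with θ _ t ht using hFd θ t ht)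
  exact key.2.differentiableAt

/-- Continuity comes from joint continuity of the integrand over a compact parameter interval;
holomorphy along an affine line is the one-variable case pulled back to that line. -/
theorem HolomorphicOn.circleIntegral {E : Type*} [AddCommGroup E] [Module ℂ E]
    [TopologicalSpace E] [ContinuousAdd E] [ContinuousSMul ℂ E] {U : Set E} (hU : IsOpen U)
    {R : ℝ} (hR : 0 ≤ R) {F : E → ℂ → ℂ}
    (hc : ContinuousOn (fun x : E × ℂ => F x.1 x.2) (U ×ˢ sphere 0 R))
    (hF : ∀ ζ ∈ sphere (0 : ℂ) R, HolomorphicOn (fun w => F w ζ) U) :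
    HolomorphicOn (fun w => ∮ ζ in C(0, R), F w ζ) U := by
  refine ⟨?_, fun w h => ?_⟩
  · rw [continuousOn_iff_continuous_domRestrict]
    refine intervalIntegral.continuous_parametric_intervalIntegral_of_continuous'
      (f := fun (x : U) (θ : ℝ) => deriv (circleMap 0 R) θ • F x (circleMap 0 R θ)) ?_ _ _
    have h1 : Continuous fun x : U × ℝ => F x.1 (circleMap 0 R x.2) := by
      rw [← continuousOn_univ]
      exact hc.comp (f := fun x : U × ℝ => ((x.1 : E), circleMap 0 R x.2)) (by fun_prop)
        fun x _ => ⟨x.1.2, circleMap_mem_sphere 0 hR _⟩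
    have h2 : Continuous fun x : U × ℝ => deriv (circleMap 0 R) x.2 := by
      simp only [deriv_circleMap]; fun_prop
    exact h2.smul h1
  · have hl : Continuous fun t : ℂ => w + t • h := by fun_prop
    refine differentiableOn_circleIntegral (hU.preimage hl) hR ?_ fun ζ hζ => (hF ζ hζ).2 w h
    exact hc.comp (f := fun x : ℂ × ℂ => (w + x.1 • h, x.2)) (by fun_prop)
      fun x hx => ⟨hx.1, hx.2⟩

/-! ### Dividing out zeros and the argument principle -/

/-- A zero of finite order of an entire function can be divided out. -/
theorem exists_eq_sub_pow_mul {a : ℂ} (n : ℕ) {f : ℂ → ℂ} (hf : Differentiable ℂ f)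
    (hn : analyticOrderAt f a = n) :
    ∃ g : ℂ → ℂ, Differentiable ℂ g ∧ g a ≠ 0 ∧ ∀ z, f z = (z - a) ^ n * g z := by
  induction n generalizing f with
  | zero =>
    refine ⟨f, hf, ?_, by simp⟩
    exact (hf.analyticAt a).analyticOrderAt_eq_zero.1 (by simpa using hn)
  | succ n ih =>
    have h0 : f a = 0 := apply_eq_zero_of_analyticOrderAt_ne_zero (by rw [hn]; simp)
    have hd : Differentiable ℂ (dslope f a) := by
      rw [← differentiableOn_univ] at hf ⊢
      exact (Complex.differentiableOn_dslope univ_mem).2 hf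
    have hfd : f = fun z => (z - a) * dslope f a z := by
      funext z
      simpa [h0] using (sub_smul_dslope f a z).symm
    have h1 : analyticOrderAt (fun z : ℂ => z - a) a = 1 := analyticOrderAt_id_sub_const_self
    have hord : analyticOrderAt (dslope f a) a = n := by
      have h2 := analyticOrderAt_mul (f := fun z : ℂ => z - a) (g := dslope f a) (z₀ := a)
        (by fun_prop) (hd.analyticAt a)
      have h3 : (fun z : ℂ => z - a) * dslope f a = f := hfd.symm
      rw [h3, hn, h1, Nat.cast_succ, add_comm (n : ℕ∞)] at h2
      exact ((WithTop.add_left_inj ENat.one_ne_top).1 h2).symm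
    obtain ⟨g, hg, hga, hfg⟩ := ih hd hord
    refine ⟨g, hg, hga, fun z => ?_⟩
    rw [hfd]
    simp only [hfg z]
    ring

/-- Dividing an entire function by its zeros at finitely many points. -/
theorem exists_eq_prod_sub_pow_mul {f : ℂ → ℂ} (hf : Differentiable ℂ f)
    (hord : ∀ z, analyticOrderAt f z ≠ ⊤) (S : Finset ℂ) :
    ∃ g : ℂ → ℂ, Differentiable ℂ g ∧ (∀ s ∈ S, g s ≠ 0) ∧
      ∀ z, f z = (∏ s ∈ S, (z - s) ^ analyticOrderNatAt f s) * g z := by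
  induction S using Finset.induction_on with
  | empty => exact ⟨f, hf, by simp, by simp⟩
  | insert a S ha ih =>
    obtain ⟨g, hg, hgS, hfg⟩ := ih
    have hprod : AnalyticAt ℂ (fun z : ℂ => ∏ s ∈ S, (z - s) ^ analyticOrderNatAt f s) a := by
      refine Finset.analyticAt_fun_prod _ fun s _ => by fun_prop
    have h0 : analyticOrderAt (fun z : ℂ => ∏ s ∈ S, (z - s) ^ analyticOrderNatAt f s) a = 0 := by
      refine hprod.analyticOrderAt_eq_zero.2 (Finset.prod_ne_zero_iff.2 fun s hs => ?_)
      exact pow_ne_zero _ (sub_ne_zero.2 fun h => ha (h ▸ hs))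
    have hga : analyticOrderAt g a = analyticOrderNatAt f a := by
      rw [Nat.cast_analyticOrderNatAt (hord a)]
      have h1 := analyticOrderAt_mul hprod (hg.analyticAt a)
      rw [h0, zero_add] at h1
      rw [← h1]
      exact congrArg (analyticOrderAt · a) (funext hfg).symm
    obtain ⟨k, hk, hka, hgk⟩ := exists_eq_sub_pow_mul _ hg hga
    refine ⟨k, hk, fun s hs => ?_, fun z => ?_⟩
    · rcases Finset.mem_insert.1 hs with rfl | hs
      · exact hka
      · exact right_ne_zero_of_mul (hgk s ▸ hgS s hs)
    · rw [Finset.prod_insert ha, hfg z, hgk z]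
      ring

/-- `Z` lists the zeros of the entire function `f` in the disk `|z| < R` with multiplicities,
and `g` is the complementary factor of `f`. -/
structure IsZeroFactorization (R : ℝ) (f : ℂ → ℂ) (Z : Multiset ℂ) (g : ℂ → ℂ) : Prop where
  mem_ball : ∀ z ∈ Z, z ∈ ball (0 : ℂ) R
  differentiable : Differentiable ℂ g
  ne_zero : ∀ z ∈ closedBall (0 : ℂ) R, g z ≠ 0
  eq_mul : ∀ z, f z = (Z.map fun a => z - a).prod * g z

theorem finite_zeros_closedBall {f : ℂ → ℂ} (hf : Differentiable ℂ f) {x : ℂ} (hx : f x ≠ 0)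
    (R : ℝ) : {z ∈ closedBall (0 : ℂ) R | f z = 0}.Finite := by
  have han : AnalyticOnNhd ℂ f univ := fun z _ => hf.analyticAt z
  have h1 := han.preimage_zero_mem_codiscrete hx
  have h2 := codiscreteWithin_mono (subset_univ (closedBall (0 : ℂ) R)) h1
  have h3 := (isCompact_closedBall (0 : ℂ) R).finite_sdiff_of_mem_codiscreteWithin h2
  refine h3.subset fun z hz => ⟨hz.1, ?_⟩
  simpa using hz.2

/-- An entire function without zeros on the circle has finitely many zeros in the disk, and
they can be divided out. -/
theorem exists_isZeroFactorization {R : ℝ} (hR : 0 < R) {f : ℂ → ℂ} (hf : Differentiable ℂ f)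
    (h0 : ∀ z ∈ sphere (0 : ℂ) R, f z ≠ 0) :
    ∃ Z g, IsZeroFactorization R f Z g ∧ Z.card = zeroCount R f := by
  have han : AnalyticOnNhd ℂ f univ := fun z _ => hf.analyticAt z
  have hRs : (R : ℂ) ∈ sphere (0 : ℂ) R := by simp [abs_of_pos hR]
  have hord : ∀ z, analyticOrderAt f z ≠ ⊤ := fun z =>
    han.analyticOrderAt_ne_top_of_isPreconnected isPreconnected_univ (mem_univ (R : ℂ))
      (mem_univ z) (by
        rw [(hf.analyticAt _).analyticOrderAt_eq_zero.2 (h0 _ hRs)]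
        simp)
  have hfin := finite_zeros_closedBall hf (h0 _ hRs) R
  obtain ⟨g, hg, hgS, hfg⟩ := exists_eq_prod_sub_pow_mul hf hord hfin.toFinset
  have hprod : ∀ z, ((∑ s ∈ hfin.toFinset, Multiset.replicate (analyticOrderNatAt f s) s).map
      fun a => z - a).prod = ∏ s ∈ hfin.toFinset, (z - s) ^ analyticOrderNatAt f s := by
    intro z
    generalize hfin.toFinset = S
    induction S using Finset.induction_on with
    | empty => simp
    | insert a S ha ih => simp [Finset.sum_insert ha, Finset.prod_insert ha, ih]
  refine ⟨∑ s ∈ hfin.toFinset, Multiset.replicate (analyticOrderNatAt f s) s, g,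
    ⟨fun z hz => ?_, hg, fun z hz => ?_, fun z => by rw [hprod, hfg z]⟩, ?_⟩
  · obtain ⟨s, hs, hzs⟩ := Multiset.mem_sum.1 hz
    obtain rfl := Multiset.eq_of_mem_replicate hzs
    obtain ⟨h1, h2⟩ := hfin.mem_toFinset.1 hs
    refine (mem_closedBall.1 h1).lt_of_ne fun h => h0 z h h2
  · intro hgz
    refine hgS z (hfin.mem_toFinset.2 ⟨hz, ?_⟩) hgz
    rw [hfg z, hgz, mul_zero]
  · rw [zeroCount, finsum_mem_eq_sum_of_subset (t := hfin.toFinset)]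
    · simp [Multiset.card_sum]
    · intro z hz
      exact hfin.mem_toFinset.2
        ⟨ball_subset_closedBall hz.1, apply_eq_zero_of_analyticOrderNatAt_ne_zero hz.2⟩
    · intro z hz
      obtain ⟨h1, h2⟩ := hfin.mem_toFinset.1 hz
      exact (mem_closedBall.1 h1).lt_of_ne fun h => h0 z h h2

namespace IsZeroFactorization

variable {R : ℝ} {f g : ℂ → ℂ} {Z : Multiset ℂ}

theorem apply_eq_zero_iff (h : IsZeroFactorization R f Z g) {z : ℂ}
    (hz : z ∈ closedBall (0 : ℂ) R) : f z = 0 ↔ z ∈ Z := by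
  rw [h.eq_mul z, mul_eq_zero, or_iff_left (h.ne_zero z hz), Multiset.prod_eq_zero_iff,
    Multiset.mem_map]
  constructor
  · rintro ⟨a, ha, haz⟩
    rwa [sub_eq_zero.1 haz]
  · exact fun hz => ⟨z, hz, sub_self z⟩

theorem differentiable_left (h : IsZeroFactorization R f Z g) : Differentiable ℂ f := by
  rw [funext h.eq_mul]
  refine Differentiable.mul ?_ h.differentiable
  clear h
  induction Z using Multiset.induction_on with
  | empty => simp
  | cons a Z ih =>
    simp only [Multiset.map_cons, Multiset.prod_cons]
    exact (differentiable_id.sub_const a).mul ih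

theorem ne_zero_of_mem_sphere (h : IsZeroFactorization R f Z g) {z : ℂ}
    (hz : z ∈ sphere (0 : ℂ) R) : f z ≠ 0 := fun h0 => by
  have h1 := h.mem_ball z ((h.apply_eq_zero_iff (sphere_subset_closedBall hz)).1 h0)
  exact (Metric.mem_ball.1 h1).ne (mem_sphere.1 hz)

/-- Supplies the induction step for statements proved by removing one zero at a time. -/
theorem of_cons {a : ℂ} (h : IsZeroFactorization R f (a ::ₘ Z) g) :
    IsZeroFactorization R (fun z => (Z.map fun b => z - b).prod * g z) Z g :=
  ⟨fun z hz => h.mem_ball z (Multiset.mem_cons_of_mem hz), h.differentiable, h.ne_zero,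
    fun _ => rfl⟩

/-- The generalized argument principle. -/
theorem circleIntegral_logDeriv (hR : 0 < R) (h : IsZeroFactorization R f Z g) {φ : ℂ → ℂ}
    (hφ : Differentiable ℂ φ) :
    (∮ ζ in C(0, R), φ ζ * (deriv f ζ / f ζ)) = 2 * Real.pi * Complex.I * (Z.map φ).sum := by
  induction Z using Multiset.induction_on generalizing f with
  | empty =>
    have hfg : f = g := by funext z; simpa using h.eq_mul z
    subst hfg
    rw [Multiset.map_zero, Multiset.sum_zero, mul_zero]
    refine Complex.circleIntegral_eq_zero_of_differentiable_on_off_countable hR.le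
      countable_empty ?_ ?_
    · exact hφ.continuous.continuousOn.mul
        (h.differentiable.deriv.continuous.continuousOn.div h.differentiable.continuous.continuousOn
          h.ne_zero)
    · intro z hz
      exact hφ.differentiableAt.mul (h.differentiable.deriv.differentiableAt.div
        h.differentiable.differentiableAt (h.ne_zero z (ball_subset_closedBall hz.1)))
  | cons a Z ih =>
    have hk := h.of_cons
    have ha : a ∈ ball (0 : ℂ) R := h.mem_ball a (Multiset.mem_cons_self a Z)
    set k : ℂ → ℂ := fun z => (Z.map fun b => z - b).prod * g z with hkdef
    have hkd := hk.differentiable_left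
    have hfk : f = fun z => (z - a) * k z := by
      funext z
      rw [h.eq_mul z, Multiset.map_cons, Multiset.prod_cons, mul_assoc]
    have hsub : ∀ ζ ∈ sphere (0 : ℂ) R, ζ - a ≠ 0 := fun ζ hζ h0 => by
      rw [sub_eq_zero.1 h0, mem_sphere] at hζ
      exact (Metric.mem_ball.1 ha).ne hζ
    -- With f = (z - a) k, the logarithmic derivative is 1/(z - a) + k'/k: Cauchy's formula
    -- evaluates the first term, induction the second.
    have heq : EqOn (fun ζ => φ ζ * (deriv f ζ / f ζ))
        (fun ζ => (ζ - a)⁻¹ • φ ζ + φ ζ * (deriv k ζ / k ζ)) (sphere 0 R) := by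
      intro ζ hζ
      have h1 : deriv f ζ = k ζ + (ζ - a) * deriv k ζ := by
        rw [hfk]
        have := (((hasDerivAt_id ζ).sub_const a).mul (hkd ζ).hasDerivAt).deriv
        simpa [Pi.mul_def] using this
      have h2 := hsub ζ hζ
      have h3 := hk.ne_zero_of_mem_sphere hζ
      have h4 : f ζ = (ζ - a) * k ζ := congrFun hfk ζ
      simp only [h1, h4, smul_eq_mul]
      field_simp
    rw [circleIntegral.integral_congr hR.le heq, circleIntegral.integral_add, ih hk,
      Multiset.map_cons, Multiset.sum_cons, mul_add,
      (hφ.diffContOnCl).circleIntegral_sub_inv_smul ha, smul_eq_mul]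
    · refine ContinuousOn.circleIntegrable hR.le ?_
      exact ((continuousOn_id.sub continuousOn_const).inv₀ hsub).smul hφ.continuous.continuousOn
    · refine ContinuousOn.circleIntegrable hR.le ?_
      exact hφ.continuous.continuousOn.mul (hkd.deriv.continuous.continuousOn.div
        hkd.continuous.continuousOn fun ζ hζ => hk.ne_zero_of_mem_sphere hζ)

end IsZeroFactorization

/-! ### Symmetric functions and discriminants -/

/-- Newton's identities for the elementary symmetric functions of a multiset. -/
theorem Multiset.mul_esymm_eq_sum {A : Type*} [CommRing A] (s : Multiset A) (k : ℕ) :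
    (k : A) * s.esymm k = (-1) ^ (k + 1) *
      ∑ a ∈ Finset.HasAntidiagonal.antidiagonal k with a.1 < k,
        (-1) ^ a.1 * s.esymm a.1 * (s.map fun x => x ^ a.2).sum := by
  classical
  have h := congrArg (MvPolynomial.aeval fun x : s.ToType => (x : A))
    (MvPolynomial.mul_esymm_eq_sum s.ToType A k)
  have hs : ∀ j : ℕ, ∑ x : s.ToType, (x : A) ^ j = (s.map fun x => x ^ j).sum := by
    intro j
    conv_rhs => rw [← Multiset.map_univ_coe s, Multiset.map_map]
    rfl
  simpa only [map_mul, map_sum, map_pow, map_neg, map_one, map_natCast, MvPolynomial.psum,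
    MvPolynomial.aeval_X, MvPolynomial.aeval_esymm_eq_multiset_esymm, Multiset.map_univ_coe,
    hs] using h

section

open Polynomial

variable {E : Type*} [AddCommGroup E] [Module ℂ E] [TopologicalSpace E] {U : Set E}

/-- If the power sums are holomorphic, then so are the elementary symmetric functions. -/
theorem HolomorphicOn.multiset_esymm {Z : E → Multiset ℂ}
    (hZ : ∀ k : ℕ, HolomorphicOn (fun w => ((Z w).map fun x => x ^ k).sum) U) (k : ℕ) :
    HolomorphicOn (fun w => (Z w).esymm k) U := by
  induction k using Nat.strong_induction_on with
  | _ k ih =>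
    rcases k.eq_zero_or_pos with rfl | hk
    · simpa [Multiset.esymm] using HolomorphicOn.const (U := U) 1
    · have hk0 : (k : ℂ) ≠ 0 := Nat.cast_ne_zero.2 hk.ne'
      have h : HolomorphicOn (fun w => (k : ℂ)⁻¹ * ((-1) ^ (k + 1) *
          ∑ a ∈ Finset.HasAntidiagonal.antidiagonal k with a.1 < k,
            (-1) ^ a.1 * (Z w).esymm a.1 * ((Z w).map fun x => x ^ a.2).sum)) U :=
        (const _).mul ((const _).mul (sum fun a ha =>
          ((const _).mul (ih a.1 (Finset.mem_filter.1 ha).2)).mul (hZ a.2)))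
      refine h.congr fun w _ => ?_
      simp only
      rw [← Multiset.mul_esymm_eq_sum, inv_mul_cancel_left₀ hk0]

/-- By Vieta the coefficients are signed elementary symmetric functions; constant cardinality is
what fixes which one belongs to a given n. -/
theorem HolomorphicOn.coeff_prod_X_sub_C {Z : E → Multiset ℂ} {m : ℕ}
    (hm : ∀ w ∈ U, (Z w).card = m)
    (hZ : ∀ k : ℕ, HolomorphicOn (fun w => ((Z w).map fun x => x ^ k).sum) U) (n : ℕ) :
    HolomorphicOn (fun w => ((Z w).map fun x => X - C x).prod.coeff n) U := by
  by_cases hn : n ≤ m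
  · refine ((const ((-1) ^ (m - n))).mul (multiset_esymm hZ (m - n))).congr fun w hw => ?_
    simp only
    rw [Multiset.prod_X_sub_C_coeff _ (by rwa [hm w hw]), hm w hw]
  · refine (const 0).congr fun w hw => coeff_eq_zero_of_natDegree_lt ?_
    rw [natDegree_multiset_prod_X_sub_C_eq_card, hm w hw]
    omega

theorem Polynomial.Monic.discr_eq_resultant {R : Type*} [CommRing R] [Nontrivial R] {f : R[X]}
    (hf : f.Monic) {m : ℕ} (hm : f.natDegree = m) (hpos : 0 < m) :
    f.discr = (-1) ^ (m * (m - 1) / 2) * resultant f f.derivative m (m - 1) := by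
  subst hm
  rw [resultant_deriv (natDegree_pos_iff_degree_pos.1 hpos), hf.leadingCoeff, mul_one,
    ← mul_assoc, ← pow_add, ← two_mul, pow_mul]
  simp

/-- For monic polynomials of fixed degree the discriminant is, up to a constant sign, a Sylvester
determinant of fixed size whose entries are 0 or coefficients of the polynomial and its derivative.
-/
theorem HolomorphicOn.polynomial_discr {Q : E → ℂ[X]} {m : ℕ} (hm : 0 < m)
    (hQ : ∀ w ∈ U, (Q w).Monic) (hdeg : ∀ w ∈ U, (Q w).natDegree = m)
    (hc : ∀ n, HolomorphicOn (fun w => (Q w).coeff n) U) :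
    HolomorphicOn (fun w => (Q w).discr) U := by
  have hdc : ∀ n, HolomorphicOn (fun w => (derivative (Q w)).coeff n) U := fun n => by
    simp only [coeff_derivative]
    exact (hc _).mul (const _)
  refine ((const _).mul (matrix_det (A := fun w =>
    sylvester (Q w) (derivative (Q w)) m (m - 1)) fun i j => ?_)).congr
      fun w hw => (hQ w hw).discr_eq_resultant (hdeg w hw) hm
  simp only [sylvester, Matrix.of_apply]
  refine Fin.addCases (fun j => ?_) (fun j => ?_) j
  · simp only [Fin.addCases_left]
    split_ifs
    exacts [hdc _, const 0]
  · simp only [Fin.addCases_right]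
    split_ifs
    exacts [hc _, const 0]

theorem Polynomial.Monic.discr_ne_zero_iff {K : Type*} [Field K] [CharZero K] {f : K[X]}
    (hf : f.Monic) (hpos : 0 < f.natDegree) : f.discr ≠ 0 ↔ f.Separable := by
  -- Characteristic zero makes the formal degree in the resultant the true degree of the derivative,
  -- so that vanishing of the resultant means failure of coprimality.
  have h1 : f.natDegree - 1 = f.derivative.natDegree := by
    rw [natDegree_derivative]
  rw [hf.discr_eq_resultant rfl hpos, h1, Ne, mul_eq_zero,
    or_iff_right (pow_ne_zero _ (neg_ne_zero.2 one_ne_zero)), resultant_eq_zero_iff, Separable]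
  simp [hf.ne_zero]

theorem discr_prod_X_sub_C_ne_zero_iff {K : Type*} [Field K] [CharZero K] {s : Multiset K}
    (hs : 0 < s.card) : (s.map fun x => X - C x).prod.discr ≠ 0 ↔ s.Nodup := by
  have hm := monic_multisetProd_X_sub_C s
  rw [hm.discr_ne_zero_iff (by rwa [natDegree_multiset_prod_X_sub_C_eq_card]),
    ← nodup_roots_iff_of_splits hm.ne_zero ?_, roots_multiset_prod_X_sub_C]
  exact Splits.multisetProd fun p hp => by
    obtain ⟨a, -, rfl⟩ := Multiset.mem_map.1 hp
    exact Splits.X_sub_C a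

end

/-! ### Functions of matrices and spectral mapping -/

section

open Polynomial

/-- Both sides are multiplicative in q, and q splits, so it is enough to treat constants and linear
factors X - a; for the latter the determinant is the characteristic polynomial at a up to sign. -/
theorem Matrix.det_aeval_eq_prod_roots {K n : Type*} [Field K] [IsAlgClosed K] [Fintype n]
    [DecidableEq n] (A : Matrix n n K) (q : K[X]) :
    (aeval A q).det = (A.charpoly.roots.map fun x => q.eval x).prod := by
  have hcard : A.charpoly.roots.card = Fintype.card n := by
    rw [← (IsAlgClosed.splits A.charpoly).natDegree_eq_card_roots, A.charpoly_natDegree_eq_dim]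
  have hX : ∀ a : K, (aeval A (X - C a)).det =
      (A.charpoly.roots.map fun x => (X - C a).eval x).prod := by
    intro a
    have h1 : aeval A (X - C a) = -(Matrix.scalar n a - A) := by
      simp [Algebra.algebraMap_eq_smul_one, Matrix.smul_one_eq_diagonal]
    have h2 : (A.charpoly.roots.map fun x => a - x).prod = A.charpoly.eval a := by
      conv_rhs => rw [(IsAlgClosed.splits A.charpoly).eq_prod_roots_of_monic A.charpoly_monic]
      rw [eval_multiset_prod, Multiset.map_map]
      simp
    rw [h1, Matrix.det_neg, ← Matrix.eval_charpoly, ← h2, ← hcard,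
      ← Multiset.card_map (fun x => a - x), ← Multiset.prod_map_neg, Multiset.map_map]
    simp
  have hC : ∀ c : K, (aeval A (C c)).det =
      (A.charpoly.roots.map fun x => (C c).eval x).prod := by
    intro c
    simp [Algebra.algebraMap_eq_smul_one, hcard]
  have hmul : ∀ r s : K[X],
      (aeval A r).det = (A.charpoly.roots.map fun x => r.eval x).prod →
      (aeval A s).det = (A.charpoly.roots.map fun x => s.eval x).prod →
      (aeval A (r * s)).det = (A.charpoly.roots.map fun x => (r * s).eval x).prod := by
    intro r s hr hs
    simp only [map_mul, Matrix.det_mul, hr, hs, eval_mul, Multiset.prod_map_mul]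
  rw [(IsAlgClosed.splits q).eq_prod_roots]
  refine hmul _ _ (hC _) ?_
  generalize q.roots = s
  induction s using Multiset.induction_on with
  | empty => simp
  | cons a s ih =>
    rw [Multiset.map_cons, Multiset.prod_cons]
    exact hmul _ _ (hX a) ih

/-- Spectral mapping with multiplicities. -/
theorem Matrix.charpoly_aeval {K n : Type*} [Field K] [IsAlgClosed K] [Fintype n]
    [DecidableEq n] (A : Matrix n n K) (q : K[X]) :
    (aeval A q).charpoly = (A.charpoly.roots.map fun x => X - C (q.eval x)).prod := by
  have : Infinite K := IsAlgClosed.instInfinite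
  refine Polynomial.funext fun l => ?_
  have h1 : Matrix.scalar n l - aeval A q = aeval A (C l - q) := by
    simp [Algebra.algebraMap_eq_smul_one, Matrix.smul_one_eq_diagonal]
  rw [Matrix.eval_charpoly, h1, Matrix.det_aeval_eq_prod_roots, eval_multiset_prod,
    Multiset.map_map]
  simp

/-- The companion matrix represents multiplication by the root in ℂ[X]/(P), whose characteristic
polynomial is the minimal polynomial of that root, namely P. -/
theorem charpoly_companionMatrix {P : ℂ[X]} (hP : P.Monic) {m : ℕ} (hm : P.natDegree = m) :
    (companionMatrix fun k : Fin m => P.coeff k).charpoly = P := by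
  subst hm
  have h1 := PowerBasis.leftMulMatrix (AdjoinRoot.powerBasis hP.ne_zero)
  have h2 := charpoly_leftMulMatrix (AdjoinRoot.powerBasis hP.ne_zero)
  rw [h1, PowerBasis.minpolyGen_eq, AdjoinRoot.minpoly_powerBasis_gen_of_monic hP] at h2
  exact h2

/-- The function `f` of a matrix whose spectrum lies in the disk `|z| < R` is a polynomial in this
matrix that interpolates `f` on the spectrum. -/
theorem exists_matrixFunction_eq_aeval {m : ℕ} {R : ℝ} (hR : 0 < R) {f : ℂ → ℂ}
    (hf : Differentiable ℂ f) (A : Matrix (Fin m) (Fin m) ℂ)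
    (hA : ∀ z ∈ A.charpoly.roots, z ∈ ball (0 : ℂ) R) :
    ∃ r : ℂ[X], matrixFunction R f A = aeval A r ∧
      ∀ z ∈ A.charpoly.roots, r.eval z = f z := by
  set P := A.charpoly with hP
  have hPm : P.Monic := A.charpoly_monic
  have hne : ∀ ζ ∈ sphere (0 : ℂ) R, P.eval ζ ≠ 0 := fun ζ hζ h0 =>
    (mem_ball.1 (hA ζ ((mem_roots hPm.ne_zero).2 h0))).ne hζ
  -- The divided difference (P(X) - P(ζ))/(X - ζ): its coefficients are continuous in ζ, and it
  -- turns the resolvent into a polynomial in A.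
  let Q : ℂ → ℂ[X] := fun ζ => P /ₘ (X - C ζ)
  have hQ : ∀ ζ, (X - C ζ) * Q ζ + C (P.eval ζ) = P := fun ζ => by
    rw [← modByMonic_X_sub_C_eq_C_eval, add_comm]
    exact modByMonic_add_div P (X - C ζ)
  have hQdeg : ∀ ζ, (Q ζ).natDegree < m + 1 := fun ζ => by
    have h1 : P.natDegree = m := by
      rw [hP, A.charpoly_natDegree_eq_dim, Fintype.card_fin]
    have h2 := natDegree_divByMonic P (monic_X_sub_C ζ)
    simp only [Q]
    omega
  have hQc : ∀ l, Continuous fun ζ => (Q ζ).coeff l := fun l => by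
    simp only [Q, coeff_divByMonic_X_sub_C]
    fun_prop
  let b : ℕ → ℂ → ℂ := fun l ζ => f ζ * ((Q ζ).coeff l / P.eval ζ)
  have hb : ∀ l, ContinuousOn (b l) (sphere 0 R) := fun l =>
    hf.continuous.continuousOn.mul ((hQc l).continuousOn.div P.continuous.continuousOn hne)
  -- Coefficients of the interpolating polynomial r(X) = (2πi)⁻¹ ∮ f(ζ) Q_ζ(X)/P(ζ) dζ.
  let c : ℕ → ℂ := fun l => (2 * (Real.pi : ℂ) * Complex.I)⁻¹ * ∮ ζ in C(0, R), b l ζ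
  have hint : ∀ v : ℕ → ℂ, ∑ l ∈ Finset.range (m + 1), c l * v l =
      (2 * (Real.pi : ℂ) * Complex.I)⁻¹ *
        ∮ ζ in C(0, R), ∑ l ∈ Finset.range (m + 1), b l ζ * v l := by
    intro v
    rw [circleIntegral.integral_fun_sum, Finset.mul_sum]
    · refine Finset.sum_congr rfl fun l _ => ?_
      simp only [c, mul_comm (b l _) (v l), circleIntegral.integral_const_mul]
      ring
    · exact fun l _ => ((hb l).mul continuousOn_const).circleIntegrable hR.le
  refine ⟨∑ l ∈ Finset.range (m + 1), C (c l) * X ^ l, ?_, fun z hz => ?_⟩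
  -- Cayley–Hamilton: substituting A in (X - ζ) Q_ζ + P(ζ) = P gives (A - ζ) Q_ζ(A) = -P(ζ).
  · have hinv : ∀ ζ ∈ sphere (0 : ℂ) R, (A - ζ • (1 : Matrix (Fin m) (Fin m) ℂ))⁻¹ =
        -((P.eval ζ)⁻¹ • aeval A (Q ζ)) := by
      intro ζ hζ
      refine Matrix.inv_eq_right_inv ?_
      have h1 := congrArg (aeval A) (hQ ζ)
      rw [map_add, map_mul, map_sub, aeval_X, aeval_C, aeval_C, hP, A.aeval_self_charpoly,
        Algebra.algebraMap_eq_smul_one, Algebra.algebraMap_eq_smul_one, ← hP] at h1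
      rw [mul_neg, mul_smul_comm, eq_neg_of_add_eq_zero_left h1, smul_neg, neg_neg, smul_smul,
        inv_mul_cancel₀ (hne ζ hζ), one_smul]
    ext i j
    have h2 : (aeval A (∑ l ∈ Finset.range (m + 1), C (c l) * X ^ l)) i j =
        ∑ l ∈ Finset.range (m + 1), c l * (A ^ l) i j := by
      simp [Matrix.sum_apply, Algebra.algebraMap_eq_smul_one]
    rw [h2, hint, matrixFunction, Matrix.of_apply, ← mul_neg]
    congr 1
    rw [← neg_one_mul, ← circleIntegral.integral_const_mul]
    refine circleIntegral.integral_congr hR.le fun ζ hζ => ?_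
    simp only [hinv ζ hζ, b]
    rw [aeval_eq_sum_range' (hQdeg ζ)]
    simp only [Matrix.neg_apply, Matrix.smul_apply, Matrix.sum_apply, smul_eq_mul]
    rw [mul_neg, mul_neg, neg_one_mul, neg_neg, Finset.mul_sum, Finset.mul_sum]
    refine Finset.sum_congr rfl fun l _ => ?_
    ring
  -- At a root z the same identity gives Q_ζ(z)/P(ζ) = 1/(ζ - z), so r(z) is Cauchy's integral for
  -- f(z).
  · have hPz : P.eval z = 0 := (mem_roots hPm.ne_zero).1 hz
    simp only [eval_finsetSum, eval_mul, eval_C, eval_pow, eval_X]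
    rw [hint, inv_mul_eq_iff_eq_mul₀ Complex.two_pi_I_ne_zero, ← smul_eq_mul,
      ← hf.diffContOnCl.circleIntegral_sub_inv_smul (hA z hz)]
    refine circleIntegral.integral_congr hR.le fun ζ hζ => ?_
    have h1 := congrArg (eval z) (hQ ζ)
    rw [eval_add, eval_mul, eval_sub, eval_X, eval_C, eval_C, hPz,
      eval_eq_sum_range' (hQdeg ζ)] at h1
    have h2 : ζ - z ≠ 0 := fun h0 =>
      (mem_ball.1 (hA z hz)).ne (by rw [← sub_eq_zero.1 h0]; exact hζ)
    have h3 := hne ζ hζ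
    simp only [b, smul_eq_mul]
    have h4 : ∑ l ∈ Finset.range (m + 1), (Q ζ).coeff l * z ^ l = P.eval ζ / (ζ - z) := by
      rw [eq_div_iff h2]
      linear_combination -h1
    have h5 : ∀ l, f ζ * ((Q ζ).coeff l / P.eval ζ) * z ^ l =
        f ζ / P.eval ζ * ((Q ζ).coeff l * z ^ l) := fun l => by ring
    simp only [h5, ← Finset.mul_sum, h4]
    field_simp

/-- The characteristic polynomial of the function `f` of the companion matrix of a polynomial. -/
theorem charpoly_matrixFunction_companionMatrix {m : ℕ} {R : ℝ} (hR : 0 < R) {f : ℂ → ℂ}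
    (hf : Differentiable ℂ f) {Z : Multiset ℂ} (hm : Z.card = m)
    (hZ : ∀ z ∈ Z, z ∈ ball (0 : ℂ) R) :
    (matrixFunction R f (companionMatrix fun k : Fin m =>
      (Z.map fun a => X - C a).prod.coeff k)).charpoly =
        ((Z.map f).map fun x => X - C x).prod := by
  have h1 := charpoly_companionMatrix (monic_multisetProd_X_sub_C Z)
    ((natDegree_multiset_prod_X_sub_C_eq_card Z).trans hm)
  set A := companionMatrix fun k : Fin m => (Z.map fun a => X - C a).prod.coeff k
  have h2 : A.charpoly.roots = Z := by rw [h1, roots_multiset_prod_X_sub_C]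
  obtain ⟨r, hr, hrf⟩ := exists_matrixFunction_eq_aeval hR hf A (by rwa [h2])
  rw [h2] at hrf
  rw [hr, Matrix.charpoly_aeval, h2, Multiset.map_map]
  congr 1
  exact Multiset.map_congr rfl fun z hz => by simp [hrf z hz]

end

/-! ### Evaluation of derivatives on the space of entire functions -/

namespace EntireSpace

variable {ρ : ℕ} {p : ℝ} {hρ : 0 < ρ} {hp : 0 < p}

theorem withSeminorms_weightedNorm : WithSeminorms (weightedNorm hρ hp) := ⟨rfl⟩

instance : IsTopologicalAddGroup (EntireSpace hρ hp) :=
  (withSeminorms_weightedNorm (hρ := hρ) (hp := hp)).topologicalAddGroup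

instance : ContinuousSMul ℂ (EntireSpace hρ hp) :=
  (withSeminorms_weightedNorm (hρ := hρ) (hp := hp)).continuousSMul

theorem differentiable (w : EntireSpace hρ hp) : Differentiable ℂ w := w.2.1

theorem differentiable_iterate_deriv (w : EntireSpace hρ hp) (k : ℕ) :
    Differentiable ℂ (deriv^[k] w) := by
  induction k with
  | zero => exact w.differentiable
  | succ k ih => rw [Function.iterate_succ_apply']; exact ih.deriv

theorem iterate_deriv_add_smul (w h : EntireSpace hρ hp) (t : ℂ) (k : ℕ) :
    deriv^[k] (w + t • h : EntireSpace hρ hp) =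
      fun z => deriv^[k] w z + t * deriv^[k] h z := by
  induction k with
  | zero => rfl
  | succ k ih =>
    simp only [Function.iterate_succ_apply', ih]
    funext z
    exact ((w.differentiable_iterate_deriv k z).hasDerivAt.add
      ((h.differentiable_iterate_deriv k z).hasDerivAt.const_mul t)).deriv

/-- The derivatives are bounded on disks by the first of the defining norms. -/
theorem exists_norm_iterate_deriv_le (hρ : 0 < ρ) (hp : 0 < p) (k : ℕ) (r : ℝ) :
    ∃ c > 0, ∀ w : EntireSpace hρ hp, ∀ z ∈ closedBall (0 : ℂ) r,
      ‖deriv^[k] w z‖ ≤ c * weightedNorm hρ hp 0 w := by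
  induction k generalizing r with
  | zero =>
    -- The exponent p + 1 is that of the weight with index 0; `max r 0` allows for negative r.
    refine ⟨Real.exp ((p + 1) * max r 0 ^ ρ), Real.exp_pos _, fun w z hz => ?_⟩
    have h1 : weight ρ p 0 z * ‖w z‖ ≤ weightedNorm hρ hp 0 w :=
      le_ciSup (bddAbove_weight_mul 0 w) z
    have h2 : ‖w z‖ ≤ Real.exp ((p + 1) * ‖z‖ ^ ρ) * weightedNorm hρ hp 0 w := by
      refine le_trans (le_of_eq ?_) (mul_le_mul_of_nonneg_left h1 (Real.exp_pos _).le)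
      rw [← mul_assoc, weight, ← Real.exp_add]
      simp
    refine h2.trans (mul_le_mul_of_nonneg_right (Real.exp_le_exp.2 ?_) (apply_nonneg _ _))
    have h3 : ‖z‖ ≤ max r 0 := (mem_closedBall_zero_iff.1 hz).trans (le_max_left _ _)
    gcongr
  | succ k ih =>
    obtain ⟨c, hc, h⟩ := ih (r + 1)
    refine ⟨c, hc, fun w z hz => ?_⟩
    rw [Function.iterate_succ_apply']
    -- Cauchy's estimate on the unit circle about z costs no constant, only an enlargement of the
    -- disk by 1.
    have := Complex.norm_deriv_le_of_forall_mem_sphere_norm_le (c := z) (R := 1)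
      (f := deriv^[k] w) (C := c * weightedNorm hρ hp 0 w) one_pos
      (w.differentiable_iterate_deriv k).diffContOnCl fun y hy => h w y ?_
    · simpa using this
    · rw [mem_closedBall_zero_iff] at hz ⊢
      have h1 : ‖y - z‖ = 1 := mem_sphere_iff_norm.1 hy
      calc ‖y‖ = ‖(y - z) + z‖ := by simp
        _ ≤ ‖y - z‖ + ‖z‖ := norm_add_le _ _
        _ ≤ r + 1 := by linarith

/-- Near (w, z), the derivative of the difference x - w is small uniformly on the disk of radius ‖z‖
+ 1 by the norm bound, and the derivative of the fixed function w is continuous. -/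
theorem continuous_iterate_deriv_apply (k : ℕ) :
    Continuous fun x : EntireSpace hρ hp × ℂ => deriv^[k] x.1 x.2 := by
  refine continuous_iff_continuousAt.2 fun ⟨w, z⟩ => ?_
  obtain ⟨c, hc, hcb⟩ := exists_norm_iterate_deriv_le hρ hp k (‖z‖ + 1)
  have h1 : Tendsto (fun x : EntireSpace hρ hp × ℂ => deriv^[k] w x.2) (𝓝 (w, z))
      (𝓝 (deriv^[k] w z)) :=
    ((w.differentiable_iterate_deriv k).continuous.comp continuous_snd).tendsto (w, z)
  have h2 : Tendsto (fun x : EntireSpace hρ hp × ℂ => deriv^[k] x.1 x.2 - deriv^[k] w x.2)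
      (𝓝 (w, z)) (𝓝 0) := by
    have hn : Continuous fun x : EntireSpace hρ hp × ℂ =>
        c * weightedNorm hρ hp 0 (x.1 - w) := by
      have := withSeminorms_weightedNorm (hρ := hρ) (hp := hp).continuous_seminorm 0
      exact continuous_const.mul (this.comp (continuous_fst.sub continuous_const))
    have hn0 := hn.tendsto (w, z)
    simp only [sub_self, map_zero, mul_zero] at hn0
    refine squeeze_zero_norm' ?_ hn0
    have hev : ∀ᶠ x : EntireSpace hρ hp × ℂ in 𝓝 (w, z), ‖x.2‖ < ‖z‖ + 1 :=
      (continuous_snd.norm.tendsto (w, z)).eventually_lt_const (by simp)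
    filter_upwards [hev] with x hx
    have h3 := hcb (x.1 - w) x.2 (mem_closedBall_zero_iff.2 hx.le)
    have h4 := congrFun (iterate_deriv_add_smul x.1 w (-1) k) x.2
    rw [neg_one_smul, ← sub_eq_add_neg] at h4
    rw [h4] at h3
    simpa [sub_eq_add_neg] using h3
  have h5 := h2.add h1
  simpa [ContinuousAt] using h5

theorem holomorphicOn_iterate_deriv_apply (k : ℕ) (z : ℂ) (U : Set (EntireSpace hρ hp)) :
    HolomorphicOn (fun w : EntireSpace hρ hp => deriv^[k] w z) U := by
  refine ⟨((continuous_iterate_deriv_apply k).comp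
    (continuous_id.prodMk continuous_const)).continuousOn, fun w h => ?_⟩
  simp only [iterate_deriv_add_smul]
  fun_prop

/-- A polynomial as an element of the space. -/
def ofPolynomial (hρ : 0 < ρ) (hp : 0 < p) (q : Polynomial ℂ) : EntireSpace hρ hp :=
  ⟨fun z => q.eval z, by
    induction q using Polynomial.induction_on' with
    | add a b ha hb => simpa [Pi.add_def] using (entireSubmodule hρ hp).add_mem ha hb
    | monomial n a =>
      have hX : (fun z : ℂ => z ^ n) ∈ entireSubmodule hρ hp := by
        refine ⟨differentiable_pow n, (hasGrowthLE_iff hρ hp (continuous_pow n)).2 fun q hq => ?_⟩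
        have hq0 : 0 < q := hp.trans hq
        refine ⟨1 + n.factorial / q ^ n, fun z => ?_⟩
        have h1 : 1 ≤ Real.exp (q * ‖z‖ ^ ρ) := Real.one_le_exp (by positivity)
        -- Monomials have growth below every positive type because xⁿ/n! ≤ exp x with x = q‖z‖^ρ;
        -- the summand 1 in the constant covers ‖z‖ ≤ 1.
        have h2 := Real.pow_div_factorial_le_exp (q * ‖z‖ ^ ρ) (by positivity) n
        have h3 : (‖z‖ ^ ρ) ^ n ≤ n.factorial / q ^ n * Real.exp (q * ‖z‖ ^ ρ) := by
          rw [div_le_iff₀ (by positivity), mul_pow] at h2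
          rw [div_mul_eq_mul_div, le_div_iff₀ (by positivity)]
          linarith
        have h4 : ‖z‖ ^ n ≤ 1 + (‖z‖ ^ ρ) ^ n := by
          rcases le_total ‖z‖ 1 with h | h
          · exact (pow_le_one₀ (norm_nonneg z) h).trans (by simp)
          · have : ‖z‖ ^ n ≤ (‖z‖ ^ ρ) ^ n :=
              pow_le_pow_left₀ (norm_nonneg z) (le_self_pow₀ h hρ.ne') n
            linarith
        rw [norm_pow, add_mul, one_mul]
        linarith
      have := (entireSubmodule hρ hp).smul_mem a hX
      simpa [Pi.smul_def] using this⟩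

theorem coe_ofPolynomial (q : Polynomial ℂ) :
    ⇑(ofPolynomial hρ hp q) = fun z => q.eval z := rfl

end EntireSpace

/-! ### Simple critical values and multisets without repetition -/

open Polynomial

namespace IsZeroFactorization

variable {R : ℝ} {f g : ℂ → ℂ} {Z : Multiset ℂ}

theorem mem_iff (h : IsZeroFactorization R f Z g) {z : ℂ} :
    z ∈ Z ↔ z ∈ ball (0 : ℂ) R ∧ f z = 0 :=
  ⟨fun hz =>
    ⟨h.mem_ball z hz, (h.apply_eq_zero_iff (ball_subset_closedBall (h.mem_ball z hz))).2 hz⟩,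
    fun hz => (h.apply_eq_zero_iff (ball_subset_closedBall hz.1)).1 hz.2⟩

/-- With f = (z - a) k one has f'(a) = k(a), and k vanishes in the disk only on the remaining list.
-/
theorem deriv_eq_zero_iff {a : ℂ} (h : IsZeroFactorization R f (a ::ₘ Z) g) :
    deriv f a = 0 ↔ a ∈ Z := by
  have hk := h.of_cons
  rw [← hk.apply_eq_zero_iff
    (ball_subset_closedBall (h.mem_ball a (Multiset.mem_cons_self a Z)))]
  set k : ℂ → ℂ := fun z => (Z.map fun b => z - b).prod * g z
  have hfk : f = fun z => (z - a) * k z := by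
    funext z
    rw [h.eq_mul z, Multiset.map_cons, Multiset.prod_cons, mul_assoc]
  have h1 := (((hasDerivAt_id a).sub_const a).mul (hk.differentiable_left a).hasDerivAt).deriv
  have h2 : deriv f a = k a := by
    rw [hfk]
    simpa [Pi.mul_def] using h1
  rw [h2]

theorem nodup_iff (h : IsZeroFactorization R f Z g) :
    Z.Nodup ↔ ∀ z ∈ ball (0 : ℂ) R, f z = 0 → deriv f z ≠ 0 := by
  rw [Multiset.nodup_iff_ne_cons_cons]
  constructor
  · intro H z hz hz0 hz2
    obtain ⟨t, rfl⟩ := Multiset.exists_cons_of_mem (h.mem_iff.2 ⟨hz, hz0⟩)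
    obtain ⟨s, rfl⟩ := Multiset.exists_cons_of_mem (h.deriv_eq_zero_iff.1 hz2)
    exact H z s rfl
  · rintro H a t rfl
    obtain ⟨ha, ha0⟩ := h.mem_iff.1 (Multiset.mem_cons_self a _)
    exact H a ha ha0 (h.deriv_eq_zero_iff.2 (Multiset.mem_cons_self a t))

/-- The simplicity of the critical values in terms of the list of critical points. -/
theorem hasSimpleCriticalValues_iff (h : IsZeroFactorization R (deriv f) Z g) :
    HasSimpleCriticalValues R f ↔ (Z.map f).Nodup := by
  rw [HasSimpleCriticalValues, ← h.nodup_iff]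
  constructor
  · rintro ⟨h1, h2⟩
    exact (Multiset.nodup_map_iff_inj_on h1).2 fun x hx y hy hxy =>
      h2 (h.mem_iff.1 hx) (h.mem_iff.1 hy) hxy
  · intro h1
    have h2 := Multiset.Nodup.of_map f h1
    exact ⟨h2, fun x hx y hy hxy => (Multiset.nodup_map_iff_inj_on h2).1 h1 x (h.mem_iff.2 hx) y
      (h.mem_iff.2 hy) hxy⟩

end IsZeroFactorization

/-- A polynomial that has critical points at given distinct points and separates them. -/
theorem exists_polynomial_eval_eq_self_derivative_eq_zero {K : Type*} [Field K]
    {s : Multiset K} (hs : s.Nodup) :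
    ∃ h : K[X], ∀ z ∈ s, h.eval z = z ∧ h.derivative.eval z = 0 := by
  set P := (s.map fun a => X - C a).prod
  have hPm : P.Monic := monic_multisetProd_X_sub_C s
  have hroots : P.roots = s := roots_multiset_prod_X_sub_C s
  have hsplit : P.Splits := Splits.multisetProd fun p hp => by
    obtain ⟨a, -, rfl⟩ := Multiset.mem_map.1 hp
    exact Splits.X_sub_C a
  obtain ⟨A, B, hAB⟩ := (nodup_roots_iff_of_splits hPm.ne_zero hsplit).1 (hroots ▸ hs)
  -- The Bézout identity A P + B P' = 1 gives B P' = 1 at each root, so the derivative 1 - P' B - P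
  -- B' vanishes there.
  refine ⟨X - P * B, fun z hz => ?_⟩
  have hPz : P.eval z = 0 := (mem_roots hPm.ne_zero).1 (hroots ▸ hz)
  have h1 := congrArg (eval z) hAB
  simp only [eval_add, eval_mul, hPz, mul_zero, zero_add, eval_one] at h1
  refine ⟨by simp [hPz], ?_⟩
  simp only [derivative_sub, derivative_X, derivative_mul, eval_sub, eval_one, eval_add, eval_mul,
    hPz]
  linear_combination -h1

/-! ### Holomorphic dependence of the critical points, and generic perturbations -/

namespace EntireSpace

variable {ρ : ℕ} {p : ℝ} {hρ : 0 < ρ} {hp : 0 < p} {R : ℝ} {U : Set (EntireSpace hρ hp)}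

theorem exists_ball_deriv_ne_zero (w₀ : EntireSpace hρ hp)
    (hw₀ : ∀ z ∈ sphere (0 : ℂ) R, deriv w₀ z ≠ 0) :
    ∃ ε > 0, ∀ w ∈ (weightedNorm hρ hp 0).ball w₀ ε, ∀ z ∈ sphere (0 : ℂ) R, deriv w z ≠ 0 := by
  obtain ⟨c, hc, hcb⟩ := exists_norm_iterate_deriv_le hρ hp 1 R
  obtain ⟨δ, hδ, hδb⟩ : ∃ δ > 0, ∀ z ∈ sphere (0 : ℂ) R, δ ≤ ‖deriv w₀ z‖ :=
    (isCompact_sphere (0 : ℂ) R).exists_forall_le'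
      w₀.differentiable.deriv.continuous.norm.continuousOn fun z hz => norm_pos_iff.2 (hw₀ z hz)
  -- Within this radius w' differs from w₀' by less than the minimum δ of the latter on the circle.
  refine ⟨δ / c, by positivity, fun w hw z hz h0 => ?_⟩
  have h1 := hcb (w - w₀) z (sphere_subset_closedBall hz)
  have h2 := congrFun (iterate_deriv_add_smul w w₀ (-1) 1) z
  rw [neg_one_smul, ← sub_eq_add_neg] at h2
  rw [h2] at h1
  simp only [Function.iterate_one, h0, zero_add, neg_one_mul, norm_neg] at h1
  rw [Seminorm.mem_ball, lt_div_iff₀' hc] at hw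
  linarith [hδb z hz]

/-- Symmetric functions of the critical points in the disk are holomorphic. -/
theorem holomorphicOn_sum_map (hR : 0 < R) (hU : IsOpen U)
    {Z : EntireSpace hρ hp → Multiset ℂ} {g : EntireSpace hρ hp → ℂ → ℂ}
    (hZ : ∀ w ∈ U, IsZeroFactorization R (deriv w) (Z w) (g w))
    {φ : EntireSpace hρ hp → ℂ → ℂ} (hφ : ∀ w, Differentiable ℂ (φ w))
    (hφc : Continuous fun x : EntireSpace hρ hp × ℂ => φ x.1 x.2)
    (hφh : ∀ z, HolomorphicOn (fun w => φ w z) U) :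
    HolomorphicOn (fun w => ((Z w).map (φ w)).sum) U := by
  have h1 : HolomorphicOn (fun w : EntireSpace hρ hp =>
      ∮ ζ in C(0, R), φ w ζ * (deriv^[2] w ζ / deriv^[1] w ζ)) U := by
    refine HolomorphicOn.circleIntegral hU hR.le ?_ fun ζ hζ => ?_
    · exact hφc.continuousOn.mul ((continuous_iterate_deriv_apply 2).continuousOn.div
        (continuous_iterate_deriv_apply 1).continuousOn
        fun x hx => (hZ x.1 hx.1).ne_zero_of_mem_sphere hx.2)
    · exact (hφh ζ).mul ((holomorphicOn_iterate_deriv_apply 2 ζ U).div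
        (holomorphicOn_iterate_deriv_apply 1 ζ U)
        fun w hw => (hZ w hw).ne_zero_of_mem_sphere hζ)
  refine ((HolomorphicOn.const (2 * Real.pi * Complex.I)⁻¹).mul h1).congr fun w hw => ?_
  have h2 := (hZ w hw).circleIntegral_logDeriv hR (hφ w)
  simp only [Function.iterate_succ_apply, Function.iterate_zero_apply]
  rw [h2, inv_mul_cancel_left₀ Complex.two_pi_I_ne_zero]

theorem card_eq_of_isPreconnected (hR : 0 < R) (hU : IsOpen U) (hUc : IsPreconnected U)
    {Z : EntireSpace hρ hp → Multiset ℂ} {g : EntireSpace hρ hp → ℂ → ℂ}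
    (hZ : ∀ w ∈ U, IsZeroFactorization R (deriv w) (Z w) (g w))
    {v w : EntireSpace hρ hp} (hv : v ∈ U) (hw : w ∈ U) : (Z v).card = (Z w).card := by
  -- With φ = 1 the sum counts the critical points; a continuous natural-number-valued function on a
  -- preconnected set is constant.
  have h1 := (holomorphicOn_sum_map hR hU hZ (φ := fun _ _ => 1)
    (fun _ => differentiable_const 1) continuous_const fun _ => HolomorphicOn.const 1).1
  have h2 : ContinuousOn (fun w => ((Z w).card : ℝ)) U := by
    refine (Complex.continuous_re.comp_continuousOn h1).congr fun w _ => ?_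
    simp
  have h3 : ContinuousOn (fun w => (Z w).card) U :=
    Nat.isClosedEmbedding_coe_real.isInducing.continuousOn_iff.2 h2
  exact hUc.constant h3 hv hw

theorem exists_notMem_add_smul_mem (hU : IsOpen U) {w : EntireSpace hρ hp} (hw : w ∈ U)
    (h : EntireSpace hρ hp) {S : Set ℂ} (hS : S.Finite) : ∃ t, t ∉ S ∧ w + t • h ∈ U := by
  have hl : Continuous fun t : ℂ => w + t • h := by fun_prop
  have h1 : {t : ℂ | w + t • h ∈ U} ∈ 𝓝 (0 : ℂ) :=
    (hU.preimage hl).mem_nhds (by simpa using hw)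
  obtain ⟨t, ht, htS⟩ := ((infinite_of_mem_nhds 0 h1).sdiff hS).nonempty
  exact ⟨t, htS, ht⟩

/-- A generic linear perturbation makes the critical points in a disk non-degenerate. -/
theorem exists_nondegenerate (hU : IsOpen U) {w₀ : EntireSpace hρ hp} (hw₀ : w₀ ∈ U)
    (hne : ∃ z, deriv w₀ z ≠ 0) :
    ∃ w ∈ U, ∀ z ∈ ball (0 : ℂ) R, deriv w z = 0 → deriv (deriv w) z ≠ 0 := by
  by_cases h2 : ∃ x, deriv (deriv w₀) x ≠ 0
  · obtain ⟨x, hx⟩ := h2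
    have hfin := finite_zeros_closedBall w₀.differentiable.deriv.deriv hx R
    -- A degenerate critical point of w₀ + t z is a zero of w₀'' at which w₀' = -t, so only finitely
    -- many t are bad.
    obtain ⟨t, ht, htU⟩ := exists_notMem_add_smul_mem hU hw₀ (ofPolynomial hρ hp X)
      (hfin.image fun z => -deriv w₀ z)
    have hX : deriv (ofPolynomial hρ hp X) = fun _ => 1 := by
      funext z
      rw [coe_ofPolynomial]
      simp
    have hd1 : deriv (w₀ + t • ofPolynomial hρ hp X : EntireSpace hρ hp) =
        fun z => deriv w₀ z + t := by
      simpa [hX] using iterate_deriv_add_smul w₀ (ofPolynomial hρ hp X) t 1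
    refine ⟨_, htU, fun z hz hz1 hz2 => ht ⟨z, ⟨ball_subset_closedBall hz, ?_⟩, ?_⟩⟩
    · rw [hd1] at hz2
      simpa using hz2
    · rw [hd1] at hz1
      exact neg_eq_of_add_eq_zero_right hz1
  · push Not at h2
    obtain ⟨x, hx⟩ := hne
    -- If w₀'' = 0 identically, w₀' is a nonzero constant and there are no critical points.
    refine ⟨w₀, hw₀, fun z _ hz => (hx ?_).elim⟩
    rw [is_const_of_deriv_eq_zero w₀.differentiable.deriv h2 x z, hz]

/-- Functions with simple critical values exist in every open set of functions with a fixed number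
of critical points in the disk. -/
theorem exists_hasSimpleCriticalValues (hU : IsOpen U) (hUne : U.Nonempty)
    {Z : EntireSpace hρ hp → Multiset ℂ} {g : EntireSpace hρ hp → ℂ → ℂ}
    (hR : 0 < R) (hZ : ∀ w ∈ U, IsZeroFactorization R (deriv w) (Z w) (g w)) {m : ℕ}
    (hm : ∀ w ∈ U, (Z w).card = m) : ∃ w ∈ U, HasSimpleCriticalValues R w := by
  obtain ⟨w₀, hw₀⟩ := hUne
  obtain ⟨w₁, hw₁, hnd⟩ := exists_nondegenerate (R := R) hU hw₀
    ⟨R, (hZ w₀ hw₀).ne_zero_of_mem_sphere (by simp [abs_of_pos hR])⟩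
  have hnodup := (hZ w₁ hw₁).nodup_iff.2 hnd
  obtain ⟨h, hh⟩ := exists_polynomial_eval_eq_self_derivative_eq_zero hnodup
  -- The excluded t are those for which w₁(x) + t x = w₁(y) + t y for some pair of critical points;
  -- diagonal pairs only exclude the harmless value 0.
  obtain ⟨t, ht, htU⟩ := exists_notMem_add_smul_mem hU hw₁ (ofPolynomial hρ hp h)
    (((Z w₁).toFinset ×ˢ (Z w₁).toFinset).finite_toSet.image
      fun x : ℂ × ℂ => -(w₁ x.1 - w₁ x.2) / (x.1 - x.2))
  set w := w₁ + t • ofPolynomial hρ hp h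
  have hw : ∀ z ∈ Z w₁, w z = w₁ z + t * z := fun z hz => by
    have h1 : w z = w₁ z + t * h.eval z := rfl
    rw [h1, (hh z hz).1]
  have hle : Z w₁ ≤ Z w := by
    refine (Multiset.le_iff_subset hnodup).2 fun z hz => (hZ w htU).mem_iff.2 ?_
    obtain ⟨hz1, hz2⟩ := (hZ w₁ hw₁).mem_iff.1 hz
    refine ⟨hz1, ?_⟩
    have h1 : deriv w z = deriv w₁ z + t * deriv (ofPolynomial hρ hp h) z :=
      congrFun (iterate_deriv_add_smul w₁ (ofPolynomial hρ hp h) t 1) z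
    rw [h1, hz2, coe_ofPolynomial, Polynomial.deriv, (hh z hz).2, mul_zero, add_zero]
  -- The old critical points persist, and since the number of critical points is fixed no new ones
  -- can appear.
  have heq : Z w₁ = Z w :=
    Multiset.eq_of_le_of_card_le hle (by rw [hm w htU, hm w₁ hw₁])
  refine ⟨w, htU, (hZ w htU).hasSimpleCriticalValues_iff.2 ?_⟩
  rw [← heq, Multiset.nodup_map_iff_inj_on hnodup]
  intro x hx y hy hxy
  by_contra hne
  refine ht ⟨(x, y), by simp [hx, hy], ?_⟩
  rw [hw x hx, hw y hy] at hxy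
  have h1 : x - y ≠ 0 := sub_ne_zero.2 hne
  simp only
  rw [div_eq_iff h1]
  linear_combination -hxy

/-- The zeros of `w'` in the disk vary holomorphically in the sense of symmetric functions. -/
theorem holomorphicOn_coeff (hR : 0 < R) (hU : IsOpen U)
    {Z : EntireSpace hρ hp → Multiset ℂ} {g : EntireSpace hρ hp → ℂ → ℂ}
    (hZ : ∀ w ∈ U, IsZeroFactorization R (deriv w) (Z w) (g w)) {m : ℕ}
    (hm : ∀ w ∈ U, (Z w).card = m) (n : ℕ) :
    HolomorphicOn (fun w => ((Z w).map fun a => X - C a).prod.coeff n) U :=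
  HolomorphicOn.coeff_prod_X_sub_C hm (fun k => holomorphicOn_sum_map hR hU hZ
    (φ := fun _ z => z ^ k) (fun _ => differentiable_pow k) (by fun_prop)
    fun z => HolomorphicOn.const _) n

/-- The critical values in the disk vary holomorphically in the sense of symmetric functions. -/
theorem holomorphicOn_coeff_map (hR : 0 < R) (hU : IsOpen U)
    {Z : EntireSpace hρ hp → Multiset ℂ} {g : EntireSpace hρ hp → ℂ → ℂ}
    (hZ : ∀ w ∈ U, IsZeroFactorization R (deriv w) (Z w) (g w)) {m : ℕ}
    (hm : ∀ w ∈ U, (Z w).card = m) (n : ℕ) :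
    HolomorphicOn (fun w => (((Z w).map w).map fun a => X - C a).prod.coeff n) U := by
  refine HolomorphicOn.coeff_prod_X_sub_C (Z := fun w => (Z w).map w)
    (fun w hw => by rw [Multiset.card_map, hm w hw]) (fun k => ?_) n
  simp only [Multiset.map_map, Function.comp_def]
  exact holomorphicOn_sum_map hR hU hZ (φ := fun w z => w z ^ k)
    (fun w => w.differentiable.pow k) ((continuous_iterate_deriv_apply 0).pow k)
    fun z => (holomorphicOn_iterate_deriv_apply 0 z U).pow k

/-- The complementary factor of the derivative is jointly holomorphic. -/
theorem holomorphicOn_complementary_factor (hR : 0 < R) (hU : IsOpen U)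
    {Z : EntireSpace hρ hp → Multiset ℂ} {g : EntireSpace hρ hp → ℂ → ℂ}
    (hZ : ∀ w ∈ U, IsZeroFactorization R (deriv w) (Z w) (g w)) {m : ℕ}
    (hm : ∀ w ∈ U, (Z w).card = m) :
    HolomorphicOn (fun x : EntireSpace hρ hp × ℂ => g x.1 x.2) (U ×ˢ ball (0 : ℂ) R) := by
  -- Written through its holomorphic coefficients, the Weierstrass polynomial is visibly jointly
  -- continuous.
  let Q : EntireSpace hρ hp → ℂ → ℂ := fun w ζ =>
    ∑ k ∈ Finset.range (m + 1), ((Z w).map fun a => X - C a).prod.coeff k * ζ ^ k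
  have hQ : ∀ w ∈ U, ∀ ζ, Q w ζ = ((Z w).map fun a => ζ - a).prod := by
    intro w hw ζ
    have h1 : ((Z w).map fun a => X - C a).prod.natDegree < m + 1 := by
      rw [natDegree_multiset_prod_X_sub_C_eq_card, hm w hw]
      exact Nat.lt_succ_self m
    simp only [Q]
    rw [← eval_eq_sum_range' h1, eval_multiset_prod, Multiset.map_map]
    simp
  have hQ0 : ∀ w ∈ U, ∀ ζ ∈ sphere (0 : ℂ) R, Q w ζ ≠ 0 := fun w hw ζ hζ => by
    have h1 := (hZ w hw).ne_zero_of_mem_sphere hζ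
    rw [(hZ w hw).eq_mul, ← hQ w hw] at h1
    exact left_ne_zero_of_mul h1
  have hQg : ∀ w ∈ U, ∀ ζ ∈ sphere (0 : ℂ) R, deriv w ζ / Q w ζ = g w ζ := fun w hw ζ hζ => by
    rw [(hZ w hw).eq_mul, ← hQ w hw, mul_div_cancel_left₀ _ (hQ0 w hw ζ hζ)]
  have hsub : ∀ z ∈ ball (0 : ℂ) R, ∀ ζ ∈ sphere (0 : ℂ) R, ζ - z ≠ 0 := fun z hz ζ hζ h0 => by
    rw [sub_eq_zero.1 h0] at hζ
    exact (mem_ball.1 hz).ne hζ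
  have hc := holomorphicOn_coeff hR hU hZ hm
  -- On the circle g = w'/Q, so Cauchy's formula carries holomorphy to all of the disk, where w'/Q
  -- itself is undefined at the zeros.
  have key : HolomorphicOn (fun x : EntireSpace hρ hp × ℂ =>
      ∮ ζ in C(0, R), (ζ - x.2)⁻¹ * (deriv^[1] x.1 ζ / Q x.1 ζ)) (U ×ˢ ball (0 : ℂ) R) := by
    refine HolomorphicOn.circleIntegral (hU.prod isOpen_ball) hR.le ?_ fun ζ hζ => ?_
    · have hd : Continuous fun x : (EntireSpace hρ hp × ℂ) × ℂ => deriv^[1] x.1.1 x.2 :=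
        (continuous_iterate_deriv_apply 1).comp
          (continuous_fst.fst.prodMk continuous_snd)
      have hQc : ContinuousOn (fun x : (EntireSpace hρ hp × ℂ) × ℂ => Q x.1.1 x.2)
          ((U ×ˢ ball 0 R) ×ˢ sphere 0 R) := by
        refine continuousOn_finsetSum _ fun k _ => ContinuousOn.mul ?_ (by fun_prop)
        exact (hc k).1.comp continuous_fst.fst.continuousOn fun x hx => hx.1.1
      refine ContinuousOn.mul (ContinuousOn.inv₀ (by fun_prop) fun x hx => ?_)
        (hd.continuousOn.div hQc fun x hx => hQ0 _ hx.1.1 _ hx.2)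
      exact hsub _ hx.1.2 _ hx.2
    · refine HolomorphicOn.mul (HolomorphicOn.inv
        ((HolomorphicOn.const ζ).sub (holomorphicOn_snd _)) fun x hx => hsub _ hx.2 _ hζ) ?_
      refine HolomorphicOn.comp_fst 
        (f := fun w : EntireSpace hρ hp => deriv^[1] w ζ / Q w ζ) ?_ (ball (0 : ℂ) R)
      exact (holomorphicOn_iterate_deriv_apply 1 ζ U).div
        (HolomorphicOn.sum fun k _ => (hc k).mul (HolomorphicOn.const _))
        fun w hw => hQ0 w hw ζ hζ
  refine ((HolomorphicOn.const (2 * Real.pi * Complex.I)⁻¹).mul key).congr fun x hx => ?_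
  have h1 := ((hZ x.1 hx.1).differentiable.diffContOnCl).circleIntegral_sub_inv_smul hx.2
  have h2 : (∮ ζ in C(0, R), (ζ - x.2)⁻¹ * (deriv^[1] x.1 ζ / Q x.1 ζ)) =
      ∮ ζ in C(0, R), (ζ - x.2)⁻¹ • g x.1 ζ :=
    circleIntegral.integral_congr hR.le fun ζ hζ => by
      simp only [Function.iterate_one, hQg x.1 hx.1 ζ hζ, smul_eq_mul]
  simp only
  rw [h2, h1, smul_eq_mul, inv_mul_cancel_left₀ Complex.two_pi_I_ne_zero]

end EntireSpace

/-! ### Assembly of the representation and the discriminant variety -/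

/-- The Weierstrass representation given by the zeros of the derivatives in the disk. -/
def weierstrassRepresentation {ρ : ℕ} {p : ℝ} {hρ : 0 < ρ} {hp : 0 < p}
    {w₀ : EntireSpace hρ hp} {R : ℝ} (hR : 0 < R) {U : Set (EntireSpace hρ hp)}
    (hU : IsOpen U) (hw₀ : w₀ ∈ U)
    {Z : EntireSpace hρ hp → Multiset ℂ} {g : EntireSpace hρ hp → ℂ → ℂ}
    (hZ : ∀ w ∈ U, IsZeroFactorization R (deriv w) (Z w) (g w))
    (hm : ∀ w ∈ U, (Z w).card = zeroCount R (deriv w₀)) :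
    WeierstrassRepresentation w₀ R U where
  isOpen := hU
  mem := hw₀
  ne_zero_on_circle w hw _ hz := (hZ w hw).ne_zero_of_mem_sphere hz
  coeff k w := ((Z w).map fun a => X - C a).prod.coeff k
  coeff_holomorphic k := EntireSpace.holomorphicOn_coeff hR hU hZ hm k
  unit := g
  unit_holomorphic := EntireSpace.holomorphicOn_complementary_factor hR hU hZ hm
  unit_ne_zero w hw := (hZ w hw).ne_zero
  factorization w hw z _ := by
    have hdeg := (natDegree_multiset_prod_X_sub_C_eq_card (Z w)).trans (hm w hw)
    have h1 := congrArg (eval z) (monic_multisetProd_X_sub_C (Z w)).as_sum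
    rw [hdeg, eval_multiset_prod, Multiset.map_map] at h1
    simp only [Function.comp_def, eval_sub, eval_X, eval_C, eval_add, eval_pow, eval_finsetSum,
      eval_mul] at h1
    rw [(hZ w hw).eq_mul z, h1, Finset.sum_range]

theorem mainTheorem10 {ρ : ℕ} {p : ℝ} (hρ : 0 < ρ) (hp : 0 < p)
    (w₀ : EntireSpace hρ hp) (R : ℝ) (hR : 0 < R)
    (hw₀ : ∀ z ∈ Metric.sphere (0 : ℂ) R, deriv w₀ z ≠ 0) :
    ∃ U : Set (EntireSpace hρ hp), IsOpen U ∧ IsConnected U ∧ w₀ ∈ U ∧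
      ∃ D : WeierstrassRepresentation w₀ R U, HolomorphicOn D.cvd U ∧
        ∃ V : Set (EntireSpace hρ hp), V ⊆ U ∧ IsPrincipalAnalyticVariety U V ∧
          V = {w ∈ U | D.cvd w = 0} ∧
          {w ∈ U | HasSimpleCriticalValues R w} = U \ V := by
  obtain ⟨ε, hε, hne⟩ := EntireSpace.exists_ball_deriv_ne_zero w₀ hw₀
  set U := (EntireSpace.weightedNorm hρ hp 0).ball w₀ ε
  have hcont : Continuous (EntireSpace.weightedNorm hρ hp 0) :=
    EntireSpace.withSeminorms_weightedNorm.continuous_seminorm 0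
  have hU : IsOpen U :=
    isOpen_lt (hcont.comp (continuous_id.sub continuous_const)) continuous_const
  have hmem : w₀ ∈ U := by simpa [U, Seminorm.mem_ball] using hε
  -- Convexity implies preconnectedness only with continuous real scalar multiplication.
  have : ContinuousSMul ℝ (EntireSpace hρ hp) := IsScalarTower.continuousSMul ℂ
  have hUc : IsPreconnected U :=
    ((EntireSpace.weightedNorm hρ hp 0).convex_ball w₀ ε).isPreconnected
  have hfac : ∀ w : EntireSpace hρ hp, ∃ (Z : Multiset ℂ) (g : ℂ → ℂ), w ∈ U →
      IsZeroFactorization R (deriv w) Z g ∧ Z.card = zeroCount R (deriv w) := by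
    intro w
    by_cases hw : w ∈ U
    · obtain ⟨Z, g, h⟩ := exists_isZeroFactorization hR w.differentiable.deriv (hne w hw)
      exact ⟨Z, g, fun _ => h⟩
    -- Arbitrary values outside U, so that Z and g are total functions.
    · exact ⟨0, 0, fun h => (hw h).elim⟩
  choose Z g hZg using hfac
  have hZ : ∀ w ∈ U, IsZeroFactorization R (deriv w) (Z w) (g w) := fun w hw => (hZg w hw).1
  have hm : ∀ w ∈ U, (Z w).card = zeroCount R (deriv w₀) := fun w hw => by
    rw [EntireSpace.card_eq_of_isPreconnected hR hU hUc hZ hw hmem, (hZg w₀ hmem).2]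
  let D := weierstrassRepresentation hR hU hmem hZ hm
  have hcvd : ∀ w ∈ U, zeroCount R (deriv w₀) ≠ 0 →
      D.cvd w = (((Z w).map w).map fun x => X - C x).prod.discr := fun w hw h0 => by
    rw [WeierstrassRepresentation.cvd, if_neg h0]
    exact congrArg discr (charpoly_matrixFunction_companionMatrix hR w.differentiable (hm w hw)
      (hZ w hw).mem_ball)
  have hhol : HolomorphicOn D.cvd U := by
    by_cases h0 : zeroCount R (deriv w₀) = 0
    · exact (HolomorphicOn.const 1).congr fun w _ => if_pos h0
    · refine (HolomorphicOn.polynomial_discr (Nat.pos_of_ne_zero h0)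
        (fun w _ => monic_multisetProd_X_sub_C _) (fun w hw => ?_)
        (EntireSpace.holomorphicOn_coeff_map hR hU hZ hm)).congr fun w hw => hcvd w hw h0
      rw [natDegree_multiset_prod_X_sub_C_eq_card, Multiset.card_map, hm w hw]
  have hiff : ∀ w ∈ U, HasSimpleCriticalValues R w ↔ D.cvd w ≠ 0 := fun w hw => by
    rw [(hZ w hw).hasSimpleCriticalValues_iff]
    by_cases h0 : zeroCount R (deriv w₀) = 0
    · have h1 : Z w = 0 := Multiset.card_eq_zero.1 ((hm w hw).trans h0)
      simp [h1, WeierstrassRepresentation.cvd, h0]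
    · rw [hcvd w hw h0, discr_prod_X_sub_C_ne_zero_iff]
      rw [Multiset.card_map, hm w hw]
      exact Nat.pos_of_ne_zero h0
  obtain ⟨v, hv, hvs⟩ :=
    EntireSpace.exists_hasSimpleCriticalValues hU ⟨w₀, hmem⟩ hR hZ hm
  refine ⟨U, hU, ⟨⟨w₀, hmem⟩, hUc⟩, hmem, D, hhol, {w ∈ U | D.cvd w = 0}, sep_subset _ _,
    ⟨hU, D.cvd, hhol, fun x hx => ⟨v, ?_, (hiff v hv).1 hvs⟩, rfl⟩, rfl, ?_⟩
  -- U is its own only component, so the single function v serves as the non-vanishing witness for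
  -- every x.
  · rwa [hUc.connectedComponentIn hx]
  · ext w
    constructor
    · exact fun hw => ⟨hw.1, fun h => (hiff w hw.1).1 hw.2 h.2⟩
    · exact fun hw => ⟨hw.1, (hiff w hw.1).2 fun h => hw.2 ⟨hw.1, h⟩⟩

end
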